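/- **Setting.** Let $\mathbb{G}$ be a simple graph with vertices $1,\dots,n$ ($n\ge 3$) and edges $1,\dots,m$, each edge oriented from a tail to a head. For a multi-point $x=(x_1,\dots,x_n)\in(\mathbb{R}^2)^n$ put $z_k=x_i-x_j$ if edge $k$ has head $i$ and tail $j$. With positive target distances $d_k$ let $e_k=\|z_k\|^2-d_k^2$. For a mismatch error $\mu\in\mathbb{R}^m$ the *overall system* is $$\dot x_i=-\sum_{k:\ i\text{ head of }k}z_ke_k+\sum_{k:\ i\text{ tail of }k}z_k(e_k+\mu_k),\qquad\text{i.e. } \dot x=-R'e+S'\mu ,$$ where $R=\mathrm{diag}(z_1,\dots,z_m)'(H\otimes I_2)$ is the rigidity matrix, $H$ is the $m\times n$ matrix with $1$ at the head and $-1$ at the tail of each edge, and $S=\mathrm{diag}(z_1,\dots,z_m)'(J\otimes I_2)$, where $J$ is $-H$ with its negative entries replaced by $0$. A formation $\{\mathbb{G},x\}$ is infinitesimally rigid if $\operatorname{rank}R=2n-3$, and minimally so if this fails after the removal of any edge. Let $\{\mathbb{G},y\}$ be a target formation: it is infinitesimally rigid and $e=0$ at $y$. Let $\tilde{\mathbb{G}}$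 be a spanning subgraph for which $\{\tilde{\mathbb{G}},y\}$ is minimally infinitesimally rigid; let $\tilde P e$ and $\hat P e$ be the subvectors of $e$ belonging to the edges in $\tilde{\mathbb{G}}$ and to the other edges, and let $\tilde R=\tilde PR$. An *ambient space* $\mathcal{A}\subset\mathbb{R}^{2n}$ is an open set containing $y$, invariant under translations and rotations, such that $\{\tilde{\mathbb{G}},x\}$ is minimally infinitesimally rigid for every $x\in\mathcal{A}$ and every inner product $(x_i-x_j)'(x_k-x_l)$ is on $\mathcal{A}$ a smooth function of $\tilde Pe$. Then $\hat Pe=\psi(\tilde Pe)$ on $\mathcal{A}$ for a smooth $\psi$; let $F$ be the Jacobian matrix of $\psi$. The *error system* is $\dot\epsilon=g(\epsilon,\mu)$ with $g(\epsilon,\mu)=-2\tilde R\tilde R'\epsilon-2\tilde R\tilde R'F'(\epsilon)\psi(\epsilon)+2\tilde RS'\mu$, evaluated at any $x\in\mathcal{A}$ with $\tilde Pe=\epsilon$. Let $\mathcal{M}\subset\mathbb{R}^m$ be an open neighbourhood of $0$ and $\mu\mapsto\epsilon_\mu$ a smooth function on $\mathcal{M}$ with values in the domain of the error system, $\epsilon_0=0$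 and $g(\epsilon_\mu,\mu)=0$. The equilibrium output is $\mathfrak{e}_\mu=\tilde P'\epsilon_\mu+\hat P'\psi(\epsilon_\mu)$. An *equilibrium solution* for $\mu\in\mathcal{M}$ is a solution $\bar x:[0,\infty)\to\mathcal{A}$ of the overall system along which $e=\mathfrak{e}_\mu$; $\bar z$ denotes its vector of relative positions $z_k$. **Theorem.** An ambient space $\mathcal{A}$ exists, and for every ambient space such $\mathcal{M}$ and $\mu\mapsto\epsilon_\mu$ exist. For every such choice and every $\mu\in\mathcal{M}$, equilibrium solutions exist. Along every equilibrium solution $\bar x$ the formation $\{\mathbb{G},\bar x(t)\}$ is infinitesimally rigid with edge lengths $((\mathfrak{e}_\mu)_k+d_k^2)^{1/2}$, and: 1. If $\bar z$ is constant then, depending only on the value of $\mu$, either all agents are fixed, or all agents move off to infinity with one common constant nonzero velocity. 2. If $\bar z$ is not constant, then there are an angular speed $\omega>0$, a direction (clockwise or counterclockwise) and a point $q$ in the plane such that all agents, and the formation as a whole, rotate about $q$ in that direction with angular speed $\omega$; so every agent moves along a circle centred at $q$ (of radius $0$ if the agent is located at $q$). Moreover, suppose that $\{\mathbb{G},y\}$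 is unaligned, i.e. $y_i-y_j$ and $y_k-y_l$ are linearly independent for any four distinct $i,j,k,l$. Then there is an open neighbourhood $\mathcal{M}_0\subset\mathcal{M}$ of $0$ such that for almost all $\mu\in\mathcal{M}_0$ (all $\mu$ in an open dense subset of $\mathcal{M}_0$ whose complement in $\mathcal{M}_0$ has Lebesgue measure zero), along every equilibrium solution, $\bar z$ is not constant and the rotation described in 2 occurs, with all radii positive. -/

import Mathlib

namespace Formation

/-- The plane `ℝ²` with its Euclidean norm. -/
abbrev Plane : Type := EuclideanSpace ℝ (Fin 2)

/-- Multi-points: the positions of `n` labelled agents in the plane. -/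
abbrev Config (n : ℕ) : Type := Fin n → Plane

/-- A labelling of the edges of the simple graph `G` by `1, …, m`, together with an orientation
of every edge: edge `k` joins its head `head k` to its tail `tail k`. -/
structure OrientedLabelling {n : ℕ} (G : SimpleGraph (Fin n)) (m : ℕ) where
  /-- the head of each edge -/
  head : Fin m → Fin n
  /-- the tail of each edge -/
  tail : Fin m → Fin n
  adj : ∀ k, G.Adj (head k) (tail k)
  exists_unique_label : ∀ i j, G.Adj i j → ∃! k, s(head k, tail k) = s(i, j)

/-- Rotation of the plane about the origin by the angle `θ` (counterclockwise for `θ > 0`). -/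
noncomputable def rot (θ : ℝ) (p : Plane) : Plane :=
  !₂[Real.cos θ * p 0 - Real.sin θ * p 1, Real.sin θ * p 0 + Real.cos θ * p 1]

/-- The wedge product `p ∧ q = det [p q]` of two vectors in the plane. -/
def wedge (p q : Plane) : ℝ := p 0 * q 1 - p 1 * q 0

/-- A multi-point is unaligned if no line through two of its points is parallel to the line
through two other points. -/
def Unaligned {n : ℕ} (x : Config n) : Prop :=
  ∀ i j k l : Fin n, [i, j, k, l].Nodup → wedge (x i - x j) (x k - x l) ≠ 0

section System

variable {n m : ℕ} {G : SimpleGraph (Fin n)} (o : OrientedLabelling G m)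

/-- The relative positions `z = (H ⊗ I) x`: `z_k` is the head minus the tail of edge `k`. -/
def relPos (x : Config n) : Fin m → Plane := fun k => x (o.head k) - x (o.tail k)

/-- The error functions `e_k = ‖z_k‖² - d_k²`, as functions of the multi-point. -/
noncomputable def err (d : Fin m → ℝ) (x : Config n) : Fin m → ℝ :=
  fun k => ‖relPos o x k‖ ^ 2 - d k ^ 2

/-- The `m × n` matrix `H`: `1` at the head, `-1` at the tail, `0` elsewhere. -/
def incH : Matrix (Fin m) (Fin n) ℝ :=
  fun k i => if i = o.head k then 1 else if i = o.tail k then -1 else 0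

/-- The matrix `J`: the result of replacing the negative entries of `-H` by zeros. -/
noncomputable def incJ : Matrix (Fin m) (Fin n) ℝ :=
  fun k i => max (-(incH o k i)) 0

/-- The rigidity matrix `R = D(z)' (H ⊗ I)`, with `D(z) = diag(z_1, …, z_m)`, at `z = (H ⊗ I) x`. -/
def matR (x : Config n) : Matrix (Fin m) (Fin n × Fin 2) ℝ :=
  fun k ic => incH o k ic.1 * relPos o x k ic.2

/-- The matrix `S = D(z)' (J ⊗ I)` at `z = (H ⊗ I) x`. -/
noncomputable def matS (x : Config n) : Matrix (Fin m) (Fin n × Fin 2) ℝ :=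
  fun k ic => incJ o k ic.1 * relPos o x k ic.2

/-- The right-hand side of the overall system:
`ẋ_i = - ∑_{i head of k} z_k e_k + ∑_{i tail of k} z_k (e_k + μ_k)`. -/
noncomputable def overallField (d μ : Fin m → ℝ) (x : Config n) : Config n := fun i =>
  -(∑ k with o.head k = i, err o d x k • relPos o x k)
    + ∑ k with o.tail k = i, (err o d x k + μ k) • relPos o x k

/-- The formation with the multi-point `x` and the vertices of `G`, but with the edges in `T` only,
is infinitesimally rigid: its rigidity matrix has rank `2n - 3`. -/
def SubInfRigid (T : Finset (Fin m)) (x : Config n) : Prop :=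
  ((matR o x).submatrix (fun k : {k // k ∈ T} => (k : Fin m)) id).rank = 2 * n - 3

/-- The formation `{G, x}` is infinitesimally rigid. -/
def InfRigid (x : Config n) : Prop := (matR o x).rank = 2 * n - 3

/-- The formation with multi-point `x` and edges in `T` is infinitesimally rigid, and ceases to be
so whenever an edge is removed. -/
def SubMinInfRigid (T : Finset (Fin m)) (x : Config n) : Prop :=
  SubInfRigid o T x ∧ ∀ k ∈ T, ¬ SubInfRigid o (T.erase k) x

/-- `{G, y}` is a target formation for the (positive) target distances `d`. -/
structure IsTargetFormation (d : Fin m → ℝ) (y : Config n) : Prop where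
  pos : ∀ k, 0 < d k
  dist_eq : ∀ k, ‖relPos o y k‖ = d k
  infRigid : InfRigid o y

variable (d : Fin m → ℝ) (T : Finset (Fin m))

/-- The reduced error `ẽ = P̃ e`: the entries of `e` that belong to the edges in `T`. -/
noncomputable def redErr (x : Config n) : {k // k ∈ T} → ℝ := fun k => err o d x k

open scoped ContDiff in
/-- `A` is an ambient space for the target formation `{G, y}` and the reduced graph with edges `T`:
an open set around `y`, invariant under translations and rotations, on which the reduced formation
is minimally infinitesimally rigid and all inner products of differences of positions are smooth
functions of the reduced error. -/
structure IsAmbientSpace (y : Config n) (A : Set (Config n)) : Prop where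
  isOpen : IsOpen A
  mem : y ∈ A
  invariant : ∀ x ∈ A, ∀ (θ : ℝ) (v : Plane), (fun i => rot θ (x i) + v) ∈ A
  minInfRigid : ∀ x ∈ A, SubMinInfRigid o T x
  inner_eq : ∀ i j k l : Fin n, ∃ η : ({k // k ∈ T} → ℝ) → ℝ,
    ContDiffOn ℝ ∞ η (redErr o d T '' A) ∧
      ∀ x ∈ A, inner ℝ (x i - x j) (x k - x l) = η (redErr o d T x)

variable (A : Set (Config n))

/-- A point of `A` with a given reduced error. Functions of such a point are used below only where
their value does not depend on which point of `A` with that reduced error is taken. -/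
noncomputable def pointOf (ε : {k // k ∈ T} → ℝ) : Config n :=
  Function.invFunOn (redErr o d T) A ε

/-- The function `ψ` with `P̂ e = ψ(P̃ e)` on `A`, where `P̂ e` consists of the entries of `e` that
belong to the edges not in `T`. -/
noncomputable def psi (ε : {k // k ∈ T} → ℝ) : {k // k ∉ T} → ℝ :=
  fun k => err o d (pointOf o d T A ε) k

/-- The Jacobian matrix `F` of `ψ`. -/
noncomputable def psiJac (ε : {k // k ∈ T} → ℝ) : Matrix {k // k ∉ T} {k // k ∈ T} ℝ :=
  LinearMap.toMatrix' (fderiv ℝ (psi o d T A) ε).toLinearMap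

/-- The reduced rigidity matrix `R̃ = P̃ R`. -/
def matRred (x : Config n) : Matrix {k // k ∈ T} (Fin n × Fin 2) ℝ :=
  (matR o x).submatrix (fun k => (k : Fin m)) id

open Matrix in
/-- The right-hand side `g(ε, μ) = -2 R̃ R̃' ε - 2 R̃ R̃' F'(ε) ψ(ε) + 2 R̃ S' μ` of the error system
`ε̇ = g(ε, μ)`, the matrices being taken at a point of `A` with reduced error `ε`. -/
noncomputable def errorField (ε : {k // k ∈ T} → ℝ) (μ : Fin m → ℝ) : {k // k ∈ T} → ℝ :=
  let x := pointOf o d T A ε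
  let Rr := matRred o T x
  (-2 : ℝ) • ((Rr * Rrᵀ) *ᵥ ε)
    - (2 : ℝ) • ((Rr * Rrᵀ * (psiJac o d T A ε)ᵀ) *ᵥ psi o d T A ε)
    + (2 : ℝ) • ((Rr * (matS o x)ᵀ) *ᵥ μ)

open scoped ContDiff in
/-- `M` is an open neighbourhood of `0`, and `μ ↦ ε μ` is a smooth function on `M` with `ε 0 = 0`
whose value at each `μ` in `M` is an equilibrium state of the error system `ε̇ = g(ε, μ)`. -/
structure IsEquilibriumBranch (M : Set (Fin m → ℝ))
    (ε : (Fin m → ℝ) → ({k // k ∈ T} → ℝ)) : Prop where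
  isOpen : IsOpen M
  zero_mem : (0 : Fin m → ℝ) ∈ M
  smooth : ContDiffOn ℝ ∞ ε M
  map_zero : ε 0 = 0
  mem_domain : ∀ μ ∈ M, ε μ ∈ redErr o d T '' A
  equilibrium : ∀ μ ∈ M, errorField o d T A (ε μ) μ = 0

open Classical in
/-- The equilibrium output `P̃' ε + P̂' ψ(ε)` belonging to an equilibrium state `ε`. -/
noncomputable def eqOutput (ε : {k // k ∈ T} → ℝ) : Fin m → ℝ :=
  fun k => if h : k ∈ T then ε ⟨k, h⟩ else psi o d T A ε ⟨k, h⟩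

/-- `x` is a solution on `[0, ∞)` of the overall system with mismatch error `μ`, it stays in `A`,
and its error is constantly equal to `E`. -/
structure IsEquilibriumSolution (μ E : Fin m → ℝ) (x : ℝ → Config n) : Prop where
  hasDeriv : ∀ t, 0 ≤ t → HasDerivWithinAt x (overallField o d μ (x t)) (Set.Ici 0) t
  mem : ∀ t, 0 ≤ t → x t ∈ A
  err_eq : ∀ t, 0 ≤ t → err o d (x t) = E

/-- The relative positions are constant along `x`. -/
def RelPosConst (x : ℝ → Config n) : Prop :=
  ∀ t, 0 ≤ t → relPos o (x t) = relPos o (x 0)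

end System

/-- All agents are fixed. -/
def Stationary {n : ℕ} (x : ℝ → Config n) : Prop := ∀ t, 0 ≤ t → x t = x 0

/-- All agents move off to infinity with one common constant velocity. -/
def Drifts {n : ℕ} (x : ℝ → Config n) : Prop :=
  ∃ v : Plane, v ≠ 0 ∧ ∀ i, (∀ t, 0 ≤ t → x t i = x 0 i + t • v) ∧
    Filter.Tendsto (fun t => ‖x t i‖) Filter.atTop Filter.atTop

/-- All agents, and the formation as a whole, rotate about `q` with angular speed `ω > 0`, all of
them counterclockwise (`σ = 1`) or all of them clockwise (`σ = -1`). -/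
def RotatesAbout {n : ℕ} (x : ℝ → Config n) (ω σ : ℝ) (q : Plane) : Prop :=
  0 < ω ∧ (σ = 1 ∨ σ = -1) ∧ ∀ t, 0 ≤ t → ∀ i, x t i = q + rot (σ * ω * t) (x 0 i - q)

end Formation

open Formation

/-! ### Inner products and rotations of the plane -/

namespace Formation

/-! Write J for the quarter turn. The error field is the derivative of the reduced error along the
overall field (`IsAmbientSpace.errorField_eq_redRigMap`). At an equilibrium no edge of the rigid
reduced graph changes length, so the velocities form an infinitesimal rigid motion `a + w J x_i`
(`IsAmbientSpace.exists_forceField_eq`). With the error frozen, the overall system is a linear ODE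
that commutes with rotations and ignores translations. The rigid motion generated by that velocity
field therefore solves it, and by uniqueness it is the equilibrium solution
(`IsEquilibriumSolution.eq_rigidMotion`): a translation if `w = 0`, a rotation about `w⁻¹ J a`
otherwise. Speeds are determined by inner products of relative positions, hence by the reduced
error, so rest or drift is decided by `μ` alone.

Ambient spaces come from the inverse function theorem, applied to the reduced error together with
three coordinates that fix position and direction (`exists_isAmbientSpace`). The branch comes from
the implicit function theorem: since `ψ(0) = 0`, the linearization of the error field at `0` is `-2
R̃R̃'(I + F'F)`, a product of two positive definite matrices up to the factor.

For generic `μ`, rotation about a point occupied by no agent amounts to finitely many smooth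
functions of `μ` being nonzero (`velInner`, its values and one difference). They vanish at `μ = 0`,
so it is enough that their differentials there do not: zero sets of regular points are null. The
differentials involve the unknown derivative of the equilibrium output, but in the virtual work
identity `sum_inner_forceField` the error drops out against rigid test motions. A rotation about the
centroid shows that `w` is not zero to first order, and a translation shows that no agent stays at
rest to first order. -/

theorem plane_inner (p q : Plane) : inner ℝ p q = p 0 * q 0 + p 1 * q 1 := by
  simp [PiLp.inner_apply, Fin.sum_univ_two, mul_comm]

theorem plane_norm_sq (p : Plane) : ‖p‖ ^ 2 = p 0 ^ 2 + p 1 ^ 2 := by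
  rw [← real_inner_self_eq_norm_sq, plane_inner]; ring

theorem plane_ext {p q : Plane} (h0 : p 0 = q 0) (h1 : p 1 = q 1) : p = q := by
  ext i; fin_cases i <;> assumption

/-- The rotation of the plane by a quarter turn. -/
def quarterTurn : Plane →ₗ[ℝ] Plane where
  toFun p := !₂[-p 1, p 0]
  map_add' p q := by apply plane_ext <;> simp; ring
  map_smul' c p := by apply plane_ext <;> simp

@[simp] theorem quarterTurn_zero_apply (p : Plane) : quarterTurn p 0 = -p 1 := rfl

@[simp] theorem quarterTurn_one_apply (p : Plane) : quarterTurn p 1 = p 0 := rfl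

/-- The linear map of the plane with matrix `!![a, -b; b, a]`. -/
noncomputable def turn (a b : ℝ) : Plane →ₗ[ℝ] Plane := a • LinearMap.id + b • quarterTurn

@[simp] theorem turn_zero_apply (a b : ℝ) (p : Plane) : turn a b p 0 = a * p 0 - b * p 1 := by
  simp [turn]; ring

@[simp] theorem turn_one_apply (a b : ℝ) (p : Plane) : turn a b p 1 = a * p 1 + b * p 0 := by
  simp [turn]

theorem rot_eq_turn (θ : ℝ) (p : Plane) : rot θ p = turn (Real.cos θ) (Real.sin θ) p := by
  apply plane_ext <;> simp [rot]; ring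

theorem inner_turn_left (a b : ℝ) (p q : Plane) :
    inner ℝ (turn a b p) q = inner ℝ p (turn a (-b) q) := by
  simp only [plane_inner, turn_zero_apply, turn_one_apply]; ring

theorem inner_turn_turn {a b : ℝ} (h : a ^ 2 + b ^ 2 = 1) (p q : Plane) :
    inner ℝ (turn a b p) (turn a b q) = inner ℝ p q := by
  simp only [plane_inner, turn_zero_apply, turn_one_apply]
  linear_combination (p 0 * q 0 + p 1 * q 1) * h

theorem norm_turn {a b : ℝ} (h : a ^ 2 + b ^ 2 = 1) (p : Plane) : ‖turn a b p‖ = ‖p‖ := by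
  rw [norm_eq_sqrt_real_inner, inner_turn_turn h, ← norm_eq_sqrt_real_inner]

theorem inner_quarterTurn_self (p : Plane) : inner ℝ (quarterTurn p) p = 0 := by
  simp only [plane_inner, quarterTurn_zero_apply, quarterTurn_one_apply]; ring

theorem quarterTurn_injective : Function.Injective quarterTurn := by
  intro p q h
  have h0 := congrArg (fun r : Plane => r 0) h
  have h1 := congrArg (fun r : Plane => r 1) h
  simp only [quarterTurn_zero_apply, quarterTurn_one_apply, neg_inj] at h0 h1
  exact plane_ext h1 h0

theorem quarterTurn_eq_zero {p : Plane} : quarterTurn p = 0 ↔ p = 0 :=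
  map_eq_zero_iff _ quarterTurn_injective

theorem sq_add_sq_cos_sin (θ : ℝ) : Real.cos θ ^ 2 + Real.sin θ ^ 2 = 1 := by
  rw [add_comm]; exact Real.sin_sq_add_cos_sq θ

/-! ### Infinitesimal rigidity and its kernel -/

section Rigidity

variable {n m : ℕ} {G : SimpleGraph (Fin n)} (o : OrientedLabelling G m)

theorem OrientedLabelling.head_ne_tail (k : Fin m) : o.head k ≠ o.tail k := (o.adj k).ne

/-- The rigidity map: half the derivative of the squared edge lengths. -/
noncomputable def rigMap (x : Config n) : Config n →ₗ[ℝ] (Fin m → ℝ) where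
  toFun u k := inner ℝ (relPos o x k) (u (o.head k) - u (o.tail k))
  map_add' u v := by
    funext k; simp only [Pi.add_apply, ← inner_add_right]; congr 1; abel
  map_smul' c u := by
    funext k
    simp only [Pi.smul_apply, ← smul_sub, inner_smul_right, RingHom.id_apply, smul_eq_mul]

theorem rigMap_apply (x u : Config n) (k : Fin m) :
    rigMap o x u k = inner ℝ (relPos o x k) (u (o.head k) - u (o.tail k)) := rfl

/-- The rigidity map of the formation with the edges in `T` only. -/
noncomputable def redRigMap (T : Finset (Fin m)) (x : Config n) :
    Config n →ₗ[ℝ] ({k // k ∈ T} → ℝ) :=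
  (LinearMap.funLeft ℝ ℝ (fun k : {k // k ∈ T} => (k : Fin m))) ∘ₗ rigMap o x

theorem redRigMap_apply (T : Finset (Fin m)) (x u : Config n) (k : {k // k ∈ T}) :
    redRigMap o T x u k = inner ℝ (relPos o x k) (u (o.head k) - u (o.tail k)) := rfl

/-- The coordinates of a multi-point. -/
def coords (n : ℕ) : Config n ≃ₗ[ℝ] (Fin n × Fin 2 → ℝ) where
  toFun u ic := u ic.1 ic.2
  map_add' _ _ := rfl
  map_smul' _ _ := rfl
  invFun v i := WithLp.toLp 2 fun c => v (i, c)
  left_inv _ := rfl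
  right_inv _ := rfl

@[simp] theorem coords_apply (u : Config n) (ic : Fin n × Fin 2) : coords n u ic = u ic.1 ic.2 :=
  rfl

theorem sum_incH_mul (k : Fin m) (f : Fin n → ℝ) :
    ∑ i, incH o k i * f i = f (o.head k) - f (o.tail k) := by
  have h : ∀ i, incH o k i * f i
      = (if i = o.head k then f i else 0) - (if i = o.tail k then f i else 0) := by
    intro i
    unfold incH
    have := o.head_ne_tail k
    split_ifs with h1 h2 <;> simp_all
  simp [h]

open Matrix in
theorem matR_mulVec (x u : Config n) : matR o x *ᵥ coords n u = rigMap o x u := by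
  funext k
  simp only [mulVec, dotProduct, matR, coords_apply, Fintype.sum_prod_type, Fin.sum_univ_two,
    rigMap_apply, plane_inner]
  rw [Finset.sum_add_distrib]
  have h0 := sum_incH_mul o k fun i => relPos o x k 0 * u i 0
  have h1 := sum_incH_mul o k fun i => relPos o x k 1 * u i 1
  simp only [← mul_assoc] at h0 h1
  rw [h0, h1]
  simp; ring

theorem rank_matR (x : Config n) : (matR o x).rank = Module.finrank ℝ (rigMap o x).range := by
  have : rigMap o x = (matR o x).mulVecLin ∘ₗ (coords n).toLinearMap := by
    ext1 i; ext1 v; exact (matR_mulVec o x _).symm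
  rw [this, LinearMap.range_comp_of_range_eq_top _ (LinearEquiv.range _), Matrix.rank]

theorem rank_matRred (T : Finset (Fin m)) (x : Config n) :
    (matRred o T x).rank = Module.finrank ℝ (redRigMap o T x).range := by
  have : redRigMap o T x = (matRred o T x).mulVecLin ∘ₗ (coords n).toLinearMap := by
    ext1 i; ext1 v; funext k; exact (congrFun (matR_mulVec o x _) k).symm
  rw [this, LinearMap.range_comp_of_range_eq_top _ (LinearEquiv.range _), Matrix.rank]

variable {o} {T : Finset (Fin m)} {x : Config n}

theorem subInfRigid_iff :
    SubInfRigid o T x ↔ Module.finrank ℝ (redRigMap o T x).range = 2 * n - 3 := by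
  rw [← rank_matRred]; rfl

theorem infRigid_iff :
    InfRigid o x ↔ Module.finrank ℝ (rigMap o x).range = 2 * n - 3 := by
  rw [← rank_matR]; rfl

theorem finrank_config (n : ℕ) : Module.finrank ℝ (Config n) = 2 * n := by
  simp [Config, Module.finrank_pi_fintype, mul_comm]

/-- The infinitesimal rigid motions of a multi-point. -/
def trivialMotion (x : Config n) : Plane × ℝ →ₗ[ℝ] Config n where
  toFun a i := a.1 + a.2 • quarterTurn (x i)
  map_add' a b := by funext i; simp only [Prod.fst_add, Prod.snd_add, Pi.add_apply]; module
  map_smul' c a := by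
    funext i; simp only [Prod.smul_fst, Prod.smul_snd, Pi.smul_apply, RingHom.id_apply]
    rw [smul_add, smul_smul]; rfl

theorem trivialMotion_injective {x : Config n} {i j : Fin n} (h : x i ≠ x j) :
    Function.Injective (trivialMotion x) := by
  rw [injective_iff_map_eq_zero]
  rintro ⟨a, w⟩ h0
  have hi : a + w • quarterTurn (x i) = 0 := congrFun h0 i
  have hj : a + w • quarterTurn (x j) = 0 := congrFun h0 j
  have hij : w • quarterTurn (x i - x j) = 0 := by
    rw [map_sub, smul_sub, sub_eq_zero]
    exact add_left_cancel (hi.trans hj.symm)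
  rcases smul_eq_zero.1 hij with rfl | h'
  · simpa using hi
  · exact absurd (sub_eq_zero.1 (quarterTurn_eq_zero.1 h')) h

theorem rigMap_trivialMotion (o : OrientedLabelling G m) (x : Config n) (a : Plane × ℝ) :
    rigMap o x (trivialMotion x a) = 0 := by
  funext k
  simp only [rigMap_apply, trivialMotion, LinearMap.coe_mk, AddHom.coe_mk, add_sub_add_left_eq_sub,
    ← smul_sub, ← map_sub, inner_smul_right, Pi.zero_apply]
  rw [real_inner_comm]
  exact mul_eq_zero_of_right _ (inner_quarterTurn_self _)


theorem SubInfRigid.exists_relPos_ne_zero (hn : 3 ≤ n) (h : SubInfRigid o T x) :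
    ∃ k ∈ T, relPos o x k ≠ 0 := by
  by_contra! hc
  have : redRigMap o T x = 0 := by
    ext1 i; ext1 v; funext k
    simp [redRigMap_apply, hc k k.2]
  rw [subInfRigid_iff, this, LinearMap.range_zero, finrank_bot] at h
  omega

theorem SubInfRigid.exists_ne (hn : 3 ≤ n) (h : SubInfRigid o T x) : ∃ i j, x i ≠ x j := by
  obtain ⟨k, -, hk⟩ := h.exists_relPos_ne_zero hn
  exact ⟨_, _, sub_ne_zero.1 hk⟩

/-- Translations and rotations always lie in the kernel. They form a space of dimension 3 because
two agents are at different places, and the kernel has dimension `2n - (2n - 3) = 3`. -/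
theorem SubInfRigid.ker_eq (hn : 3 ≤ n) (h : SubInfRigid o T x) :
    (redRigMap o T x).ker = (trivialMotion x).range := by
  obtain ⟨i, j, hij⟩ := h.exists_ne hn
  symm
  apply Submodule.eq_of_le_of_finrank_eq
  · rintro _ ⟨a, rfl⟩
    rw [LinearMap.mem_ker]
    funext k
    exact congrFun (rigMap_trivialMotion o x a) k
  · rw [LinearMap.finrank_range_of_inj (trivialMotion_injective hij)]
    have h1 := (redRigMap o T x).finrank_range_add_finrank_ker
    rw [finrank_config, subInfRigid_iff.1 h] at h1
    simp; omega

theorem SubInfRigid.exists_trivial (hn : 3 ≤ n) (h : SubInfRigid o T x) {u : Config n}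
    (hu : ∀ k ∈ T, rigMap o x u k = 0) :
    ∃ (a : Plane) (w : ℝ), ∀ i, u i = a + w • quarterTurn (x i) := by
  have : u ∈ (redRigMap o T x).ker := by
    rw [LinearMap.mem_ker]; funext k; exact hu k k.2
  rw [h.ker_eq hn] at this
  obtain ⟨⟨a, w⟩, rfl⟩ := this
  exact ⟨a, w, fun i => rfl⟩

/-- Further edges can only shrink the kernel, which already consists of trivial motions and so
cannot shrink. -/
theorem SubInfRigid.infRigid (hn : 3 ≤ n) (h : SubInfRigid o T x) : InfRigid o x := by
  have hk : (rigMap o x).ker = (redRigMap o T x).ker := by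
    apply le_antisymm
    · exact LinearMap.ker_le_ker_comp _ _
    · rw [h.ker_eq hn]
      rintro _ ⟨a, rfl⟩
      exact rigMap_trivialMotion o x a
  have h1 := (redRigMap o T x).finrank_range_add_finrank_ker
  have h2 := (rigMap o x).finrank_range_add_finrank_ker
  rw [infRigid_iff, ← subInfRigid_iff.1 h]
  rw [hk] at h2
  omega

/-- Minimality means that the rows of the rigidity matrix are independent. This turns a condition on
all edge deletions into surjectivity, which is stable under perturbation, and an edge count that
does not depend on `x`. -/
theorem subMinInfRigid_iff (hn : 3 ≤ n) :
    SubMinInfRigid o T x ↔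
      Function.Surjective (redRigMap o T x) ∧ T.card = 2 * n - 3 := by
  constructor
  · rintro ⟨h, hmin⟩
    have hs : (redRigMap o T x).range = ⊤ := by
      by_contra hne
      -- The functional `f` is a linear relation between the rows. An edge with nonzero coefficient
      -- has its row determined by the others, so deleting it leaves the kernel and hence the rank
      -- unchanged.
      obtain ⟨f, hf, hle⟩ := Submodule.exists_le_ker_of_lt_top _ (lt_top_iff_ne_top.2 hne)
      have hf' : ∀ v : {k // k ∈ T} → ℝ, f v = ∑ k, v k * f (Pi.single k 1) := by
        intro v
        conv_lhs => rw [pi_eq_sum_univ' v, map_sum]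
        refine Finset.sum_congr rfl fun k _ => ?_
        rw [← smul_eq_mul, ← map_smul, ← Pi.single_smul, smul_eq_mul, mul_one]
      obtain ⟨k, hk⟩ : ∃ k, f (Pi.single k 1) ≠ 0 := by
        by_contra! hc
        exact hf (LinearMap.ext fun v => by rw [hf' v]; simp [hc])
      apply hmin k k.2
      have hker : (redRigMap o (T.erase k) x).ker = (redRigMap o T x).ker := by
        ext u
        rw [LinearMap.mem_ker, LinearMap.mem_ker]
        constructor
        · intro hu
          have hz : ∀ l, l ≠ k → redRigMap o T x u l = 0 := fun l hl =>
            congrFun hu ⟨l, Finset.mem_erase.2 ⟨fun hh => hl (Subtype.ext hh), l.2⟩⟩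
          have h0 : f (redRigMap o T x u) = 0 := hle ⟨u, rfl⟩
          rw [hf', Finset.sum_eq_single k (fun l _ hl => by rw [hz l hl, zero_mul])
            (by simp)] at h0
          funext l
          by_cases hl : l = k
          · subst hl; exact (mul_eq_zero.1 h0).resolve_right hk
          · exact hz l hl
        · intro hu
          funext l
          exact congrFun hu ⟨l, (Finset.mem_erase.1 l.2).2⟩
      have h1 := (redRigMap o T x).finrank_range_add_finrank_ker
      have h2 := (redRigMap o (T.erase k) x).finrank_range_add_finrank_ker
      rw [subInfRigid_iff, ← subInfRigid_iff.1 h]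
      rw [hker] at h2
      omega
    refine ⟨LinearMap.range_eq_top.1 hs, ?_⟩
    rw [← subInfRigid_iff.1 h, hs, finrank_top]
    simp
  · rintro ⟨hs, hc⟩
    refine ⟨?_, fun k hk hr => ?_⟩
    · rw [subInfRigid_iff, LinearMap.range_eq_top.2 hs, finrank_top]; simp [hc]
    · have h1 := (redRigMap o (T.erase k) x).range.finrank_le
      rw [subInfRigid_iff.1 hr] at h1
      rw [Module.finrank_fintype_fun_eq_card, Fintype.card_coe, Finset.card_erase_of_mem hk, hc]
        at h1
      omega

end Rigidity

end Formation

/-! ### Existence of an ambient space -/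

namespace Formation

open scoped ContDiff Topology

/-- The inverse function theorem, with the source shrunk to points where the derivative is still
invertible. This is open because invertible maps form an open set, and it makes the inverse smooth
on the whole target rather than only near `f a`. -/
theorem exists_smooth_local_inverse {E F : Type*} [NormedAddCommGroup E] [NormedSpace ℝ E]
    [FiniteDimensional ℝ E] [NormedAddCommGroup F] [NormedSpace ℝ F] [FiniteDimensional ℝ F]
    (hdim : Module.finrank ℝ E = Module.finrank ℝ F) {f : E → F} {s : Set E} (hs : IsOpen s)
    (hf : ContDiffOn ℝ ∞ f s) {a : E} (ha : a ∈ s) (hinj : ∀ u, fderiv ℝ f a u = 0 → u = 0) :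
    ∃ e : OpenPartialHomeomorph E F, a ∈ e.source ∧ e.source ⊆ s ∧ (∀ x, e x = f x) ∧
      ContDiffOn ℝ ∞ e.symm e.target ∧ ∀ x ∈ e.source, Function.Surjective (fderiv ℝ f x) := by
  have : CompleteSpace E := FiniteDimensional.complete ℝ E
  have : CompleteSpace F := FiniteDimensional.complete ℝ F
  have hat : ∀ x ∈ s, ContDiffAt ℝ ∞ f x := fun x hx => hf.contDiffAt (hs.mem_nhds hx)
  have hne : (∞ : WithTop ℕ∞) ≠ 0 := by simp
  have hd : ∀ x ∈ s, HasFDerivAt f (fderiv ℝ f x) x := fun x hx =>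
    ((hat x hx).differentiableAt hne).hasFDerivAt
  let L : E ≃L[ℝ] F := ((fderiv ℝ f a).toLinearMap.linearEquivOfInjective
    ((injective_iff_map_eq_zero _).2 hinj) hdim).toContinuousLinearEquiv
  have hL : (L : E →L[ℝ] F) = fderiv ℝ f a := by ext u; rfl
  have hcont : ContinuousOn (fderiv ℝ f) s := hf.continuousOn_fderiv_of_isOpen hs (by simp)
  have hnhds : s ∩ fderiv ℝ f ⁻¹' Set.range ((↑) : (E ≃L[ℝ] F) → E →L[ℝ] F) ∈ 𝓝 a := by
    refine Filter.inter_mem (hs.mem_nhds ha) (hcont.continuousAt (hs.mem_nhds ha) ?_)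
    rw [← hL]; exact ContinuousLinearEquiv.nhds L
  obtain ⟨U, hU, hUo, haU⟩ := mem_nhds_iff.1 hnhds
  have hda : HasFDerivAt f (L : E →L[ℝ] F) a := hL ▸ hd a ha
  let e := ((hat a ha).toOpenPartialHomeomorph f hda hne).restrOpen U hUo
  have hsrc : e.source ⊆ U := Set.inter_subset_right
  refine ⟨e, ⟨(hat a ha).mem_toOpenPartialHomeomorph_source hda hne, haU⟩,
    fun x hx => (hU (hsrc hx)).1, fun x => rfl, fun z hz => ?_, fun x hx => ?_⟩
  · have hx := e.map_target hz
    obtain ⟨hxs, L', hL'⟩ := hU (hsrc hx)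
    exact (e.contDiffAt_symm hz (hL' ▸ hd _ hxs) (hat _ hxs)).contDiffWithinAt
  · obtain ⟨hxs, L', hL'⟩ := hU (hsrc hx)
    rw [← hL']; exact L'.surjective

section Ambient

variable {n m : ℕ} {G : SimpleGraph (Fin n)} (o : OrientedLabelling G m) (d : Fin m → ℝ)
  (T : Finset (Fin m))

theorem contDiff_err (k : Fin m) : ContDiff ℝ ∞ fun x : Config n => err o d x k := by
  unfold err relPos
  exact ((contDiff_apply ℝ Plane _).sub (contDiff_apply ℝ Plane _)).norm_sq ℝ |>.sub
    contDiff_const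

theorem contDiff_redErr : ContDiff ℝ ∞ (redErr o d T : Config n → _) :=
  contDiff_pi.2 fun k => contDiff_err o d k

theorem hasFDerivAt_err (x : Config n) (k : Fin m) :
    HasFDerivAt (fun x => err o d x k)
      ((2 : ℝ) • (LinearMap.proj k ∘ₗ rigMap o x).toContinuousLinearMap) x := by
  have h : HasFDerivAt (fun x : Config n => x (o.head k) - x (o.tail k))
      (ContinuousLinearMap.proj (R := ℝ) (φ := fun _ : Fin n => Plane) (o.head k)
        - ContinuousLinearMap.proj (R := ℝ) (φ := fun _ : Fin n => Plane) (o.tail k)) x :=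
    (hasFDerivAt_apply _ x).sub (hasFDerivAt_apply _ x)
  have := (h.norm_sq).sub_const (d k ^ 2)
  refine this.congr_fderiv ?_
  ext u
  simp [rigMap_apply, relPos, inner_sub_left, inner_sub_right]

theorem hasFDerivAt_redErr (x : Config n) :
    HasFDerivAt (redErr o d T) ((2 : ℝ) • (redRigMap o T x).toContinuousLinearMap) x := by
  rw [hasFDerivAt_pi']
  intro k
  refine (hasFDerivAt_err o d x k).congr_fderiv ?_
  ext u; rfl

theorem wedge_self (p : Plane) : wedge p p = 0 := by unfold wedge; ring

theorem wedge_quarterTurn (p : Plane) : wedge p (quarterTurn p) = ‖p‖ ^ 2 := by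
  rw [plane_norm_sq, wedge, quarterTurn_zero_apply, quarterTurn_one_apply]; ring

/-- The multi-point `x` turned and shifted such that agent `i` is at `y i` and agent `j` is on the
ray from `y i` to `y j`. -/
noncomputable def normalize (y : Config n) (i j : Fin n) (x : Config n) : Config n := fun l =>
  y i + turn (inner ℝ (x j - x i) (y j - y i) / (‖x j - x i‖ * ‖y j - y i‖))
    (wedge (x j - x i) (y j - y i) / (‖x j - x i‖ * ‖y j - y i‖)) (x l - x i)

/-- Lagrange's identity: the two coefficients are the cosine and sine of the angle from `p` to `q`.
-/
theorem normalize_coeff {p q : Plane} (hp : p ≠ 0) (hq : q ≠ 0) :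
    (inner ℝ p q / (‖p‖ * ‖q‖)) ^ 2 + (wedge p q / (‖p‖ * ‖q‖)) ^ 2 = 1 := by
  have hp' := norm_ne_zero_iff.2 hp
  have hq' := norm_ne_zero_iff.2 hq
  have h : inner ℝ p q ^ 2 + wedge p q ^ 2 = ‖p‖ ^ 2 * ‖q‖ ^ 2 := by
    rw [plane_norm_sq, plane_norm_sq, plane_inner, wedge]; ring
  field_simp
  linarith

theorem exists_normalize_eq (y x : Config n) (i j : Fin n) (hy : y i ≠ y j) (hx : x i ≠ x j) :
    ∃ (a b : ℝ) (v : Plane), a ^ 2 + b ^ 2 = 1 ∧ ∀ l, normalize y i j x l = turn a b (x l) + v := by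
  refine ⟨_, _, y i - turn (inner ℝ (x j - x i) (y j - y i) / (‖x j - x i‖ * ‖y j - y i‖))
      (wedge (x j - x i) (y j - y i) / (‖x j - x i‖ * ‖y j - y i‖)) (x i),
    normalize_coeff (sub_ne_zero.2 hx.symm) (sub_ne_zero.2 hy.symm), fun l => ?_⟩
  rw [normalize, map_sub]; abel

theorem normalize_left (y x : Config n) (i j : Fin n) : normalize y i j x i = y i := by
  simp [normalize]

theorem wedge_normalize (y x : Config n) (i j : Fin n) :
    wedge (y j - y i) (normalize y i j x j - normalize y i j x i) = 0 := by
  rw [normalize_left, normalize, add_sub_cancel_left]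
  simp only [wedge, turn_zero_apply, turn_one_apply, plane_inner]
  ring

theorem normalize_self (y : Config n) (i j : Fin n) (hy : y i ≠ y j) : normalize y i j y = y := by
  have h := norm_ne_zero_iff.2 (sub_ne_zero.2 hy.symm)
  funext l
  rw [normalize, wedge_self, real_inner_self_eq_norm_sq, zero_div, pow_two, div_self (by simp [h])]
  simp [turn]

/-- A rotation of `x` turns the angle from `x j - x i` to `y j - y i` back by the same amount. This
gives the ambient space its invariance. -/
theorem normalize_move (y x : Config n) (i j : Fin n) (θ : ℝ) (v : Plane) :
    normalize y i j (fun l => rot θ (x l) + v) = normalize y i j x := by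
  funext l
  have hcs := sq_add_sq_cos_sin θ
  simp only [normalize, add_sub_add_right_eq_sub, rot_eq_turn, ← map_sub, norm_turn hcs]
  congr 1
  apply plane_ext <;>
  · simp only [turn_zero_apply, turn_one_apply, plane_inner, wedge, div_eq_mul_inv]
    generalize (‖x j - x i‖ * ‖y j - y i‖)⁻¹ = D
    generalize x j - x i = p
    generalize y j - y i = q
    generalize x l - x i = r
    first
    | linear_combination
        ((p 0 * q 0 + p 1 * q 1) * D * r 0 - (p 0 * q 1 - p 1 * q 0) * D * r 1) * hcs
    | linear_combination
        ((p 0 * q 0 + p 1 * q 1) * D * r 1 + (p 0 * q 1 - p 1 * q 0) * D * r 0) * hcs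

theorem continuousOn_normalize (y : Config n) (i j : Fin n) (hy : y i ≠ y j) :
    ContinuousOn (normalize y i j) {x | x i ≠ x j} := by
  have hw : Continuous fun x : Config n => wedge (x j - x i) (y j - y i) := by
    unfold wedge; fun_prop
  have h : ∀ x ∈ {x : Config n | x i ≠ x j}, ‖x j - x i‖ * ‖y j - y i‖ ≠ 0 := fun x hx =>
    mul_ne_zero (norm_ne_zero_iff.2 (sub_ne_zero.2 (Ne.symm hx)))
      (norm_ne_zero_iff.2 (sub_ne_zero.2 hy.symm))
  have hq : Continuous fun p : Plane => quarterTurn p := quarterTurn.continuous_of_finiteDimensional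
  refine continuousOn_pi.2 fun l => ContinuousOn.add continuousOn_const ?_
  simp only [turn, LinearMap.add_apply, LinearMap.smul_apply, LinearMap.id_apply]
  refine ContinuousOn.add (ContinuousOn.smul (ContinuousOn.div ?_ ?_ h) ?_)
    (ContinuousOn.smul (ContinuousOn.div hw.continuousOn ?_ h) ?_) <;>
  · apply Continuous.continuousOn; fun_prop

variable {o d T}

theorem relPos_turn {a b : ℝ} {v : Plane} {x x' : Config n}
    (h : ∀ l, x' l = turn a b (x l) + v) (k : Fin m) :
    relPos o x' k = turn a b (relPos o x k) := by
  simp [relPos, h]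

theorem err_turn {a b : ℝ} (hab : a ^ 2 + b ^ 2 = 1) {v : Plane} {x x' : Config n}
    (h : ∀ l, x' l = turn a b (x l) + v) : err o d x' = err o d x := by
  funext k; rw [err, err, relPos_turn h, norm_turn hab]

theorem redErr_turn {a b : ℝ} (hab : a ^ 2 + b ^ 2 = 1) {v : Plane} {x x' : Config n}
    (h : ∀ l, x' l = turn a b (x l) + v) : redErr o d T x' = redErr o d T x := by
  have := err_turn (o := o) (d := d) hab h
  funext k; rw [redErr, redErr, this]

theorem inner_sub_turn {a b : ℝ} (hab : a ^ 2 + b ^ 2 = 1) {v : Plane} {x x' : Config n}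
    (h : ∀ l, x' l = turn a b (x l) + v) (i j k l : Fin n) :
    inner ℝ (x' i - x' j) (x' k - x' l) = inner ℝ (x i - x j) (x k - x l) := by
  simp only [h, add_sub_add_right_eq_sub, ← map_sub]
  exact inner_turn_turn hab _ _

theorem redRigMap_turn {a b : ℝ} {v : Plane} {x x' : Config n}
    (h : ∀ l, x' l = turn a b (x l) + v) (u : Config n) :
    redRigMap o T x' u = redRigMap o T x fun l => turn a (-b) (u l) := by
  funext k
  rw [redRigMap_apply, redRigMap_apply, relPos_turn h, inner_turn_left, map_sub]

/-- The reduced error together with the position of agent `i` and the displacement of agent `j`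
normal to the line through `y i` and `y j`. -/
noncomputable def chart (o : OrientedLabelling G m) (d : Fin m → ℝ) (T : Finset (Fin m))
    (y : Config n) (i j : Fin n) (x : Config n) : ({k // k ∈ T} → ℝ) × Plane × ℝ :=
  (redErr o d T x, x i, wedge (y j - y i) (x j - x i))

theorem contDiff_chart (y : Config n) (i j : Fin n) : ContDiff ℝ ∞ (chart o d T y i j) := by
  refine (contDiff_redErr o d T).prodMk ((contDiff_apply ℝ Plane i).prodMk ?_)
  unfold wedge
  fun_prop

theorem fderiv_chart (y x : Config n) (i j : Fin n) (u : Config n) :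
    fderiv ℝ (chart o d T y i j) x u
      = ((2 : ℝ) • redRigMap o T x u, u i, wedge (y j - y i) (u j - u i)) := by
  let W : Config n →ₗ[ℝ] ℝ :=
    { toFun := fun x => wedge (y j - y i) (x j - x i)
      map_add' := fun u v => by simp [wedge]; ring
      map_smul' := fun c u => by simp [wedge]; ring }
  have h3 : HasFDerivAt (fun x : Config n => wedge (y j - y i) (x j - x i))
      W.toContinuousLinearMap x := W.toContinuousLinearMap.hasFDerivAt
  have h : HasFDerivAt (chart o d T y i j) _ x :=
    (hasFDerivAt_redErr o d T x).prodMk ((hasFDerivAt_apply i x).prodMk h3)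
  rw [h.fderiv]
  rfl

/-- By rigidity `chart` is a local diffeomorphism at `y`. The ambient space consists of the
multi-points whose normalized form lies in its source. Normalized points have last two coordinates
`(y i, 0)`, so the inverse chart recovers them, and with them all inner products, from the reduced
error alone. -/
theorem exists_isAmbientSpace (hn : 3 ≤ n) {y : Config n} (hT : SubMinInfRigid o T y) :
    ∃ A, IsAmbientSpace o d T y A := by
  obtain ⟨i, j, hij⟩ := hT.1.exists_ne hn
  have hcard := ((subMinInfRigid_iff hn).1 hT).2
  -- The count is `2n = (2n - 3) + 2 + 1`.
  have hdim : Module.finrank ℝ (Config n)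
      = Module.finrank ℝ (({k // k ∈ T} → ℝ) × Plane × ℝ) := by
    rw [finrank_config]; simp [hcard]; omega
  obtain ⟨e, hye, -, he, hsymm, hsurj⟩ := exists_smooth_local_inverse hdim isOpen_univ
    (contDiff_chart (o := o) (d := d) (T := T) y i j).contDiffOn (Set.mem_univ y) (fun u hu => by
      rw [fderiv_chart, Prod.mk_eq_zero, Prod.mk_eq_zero] at hu
      obtain ⟨h1, h2, h3⟩ := hu
      -- A kernel vector is a trivial motion; the wedge coordinate kills its rotation part and the
      -- position of agent `i` its translation part.
      obtain ⟨a, w, hu⟩ := hT.1.exists_trivial hn (u := u) fun k hk =>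
        congrFun ((smul_eq_zero.1 h1).resolve_left two_ne_zero) ⟨k, hk⟩
      have hw : w * ‖y j - y i‖ ^ 2 = 0 := by
        rw [← wedge_quarterTurn, ← h3, hu, hu, add_sub_add_left_eq_sub, ← smul_sub, ← map_sub]
        simp [wedge]; ring
      have hw0 : w = 0 := (mul_eq_zero.1 hw).resolve_right
        (pow_ne_zero 2 (norm_ne_zero_iff.2 (sub_ne_zero.2 hij.symm)))
      have ha : a = 0 := by rw [← h2, hu i, hw0]; simp
      funext l
      rw [hu l, hw0, ha]; simp)
  have hgauge : ∀ x, chart o d T y i j (normalize y i j x)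
      = (redErr o d T (normalize y i j x), y i, 0) := fun x => by
    rw [chart, wedge_normalize, normalize_left]
  refine ⟨{x | x i ≠ x j} ∩ normalize y i j ⁻¹' e.source, ?_, ⟨hij, ?_⟩, ?_, ?_, ?_⟩
  · refine (continuousOn_normalize y i j hij).isOpen_inter_preimage ?_ e.open_source
    exact isOpen_ne_fun (continuous_apply i) (continuous_apply j)
  · rw [Set.mem_preimage, normalize_self y i j hij]; exact hye
  · rintro x ⟨hx, hxe⟩ θ v
    refine ⟨fun h => hx ?_, ?_⟩
    · have := add_right_cancel h
      rw [rot_eq_turn, rot_eq_turn, ← sub_eq_zero, ← map_sub, ← norm_eq_zero,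
        norm_turn (sq_add_sq_cos_sin θ), norm_eq_zero, sub_eq_zero] at this
      exact this
    · rw [Set.mem_preimage, normalize_move]; exact hxe
  · rintro x ⟨hx, hxe⟩
    obtain ⟨a, b, v, hab, hN⟩ := exists_normalize_eq y x i j hij hx
    refine (subMinInfRigid_iff hn).2 ⟨fun c => ?_, hcard⟩
    obtain ⟨u, hu⟩ := hsurj _ hxe ((2 : ℝ) • c, 0, 0)
    rw [fderiv_chart, redRigMap_turn hN] at hu
    exact ⟨_, smul_right_injective _ (two_ne_zero (α := ℝ)) (Prod.ext_iff.1 hu).1⟩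
  · intro p q r s
    refine ⟨fun ε => inner ℝ (e.symm (ε, y i, 0) p - e.symm (ε, y i, 0) q)
      (e.symm (ε, y i, 0) r - e.symm (ε, y i, 0) s), ?_, ?_⟩
    · have hmaps : Set.MapsTo (fun ε : {k // k ∈ T} → ℝ => (ε, y i, (0 : ℝ)))
          (redErr o d T '' ({x | x i ≠ x j} ∩ normalize y i j ⁻¹' e.source)) e.target := by
        rintro _ ⟨x, ⟨hx, hxe⟩, rfl⟩
        obtain ⟨a, b, v, hab, hN⟩ := exists_normalize_eq y x i j hij hx
        have := e.map_source hxe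
        rwa [he, hgauge, redErr_turn hab hN] at this
      have h0 : ContDiff ℝ ∞ fun ε : {k // k ∈ T} → ℝ => (ε, y i, (0 : ℝ)) :=
        contDiff_id.prodMk contDiff_const
      have h : ContDiffOn ℝ ∞ (fun ε : {k // k ∈ T} → ℝ => e.symm (ε, y i, (0 : ℝ))) _ :=
        hsymm.comp h0.contDiffOn hmaps
      have h' := contDiffOn_pi.1 h
      exact ((h' p).sub (h' q)).inner ℝ ((h' r).sub (h' s))
    · rintro x ⟨hx, hxe⟩
      obtain ⟨a, b, v, hab, hN⟩ := exists_normalize_eq y x i j hij hx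
      have h1 : (redErr o d T x, y i, (0 : ℝ)) = e (normalize y i j x) := by
        rw [he, hgauge, redErr_turn hab hN]
      simp only [h1, e.left_inv hxe]
      exact (inner_sub_turn hab hN p q r s).symm

end Ambient

end Formation

/-! ### The velocity field with frozen error -/

namespace Formation

open scoped ContDiff Topology Matrix

section Force

variable {n m : ℕ} {G : SimpleGraph (Fin n)} (o : OrientedLabelling G m)

theorem relPos_add (x x' : Config n) (k : Fin m) :
    relPos o (x + x') k = relPos o x k + relPos o x' k := by
  simp only [relPos, Pi.add_apply]; abel

theorem relPos_smul (c : ℝ) (x : Config n) (k : Fin m) :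
    relPos o (c • x) k = c • relPos o x k := by
  simp only [relPos, Pi.smul_apply, smul_sub]

/-- The coefficient of `z_k` in the velocity of agent `i` when the error is `E`. -/
noncomputable def forceCoeff (E μ : Fin m → ℝ) (i : Fin n) (k : Fin m) : ℝ :=
  (if o.tail k = i then E k + μ k else 0) - if o.head k = i then E k else 0

/-- The right-hand side of the overall system with the error frozen at the value `E`. -/
noncomputable def forceField (E μ : Fin m → ℝ) : Config n →ₗ[ℝ] Config n where
  toFun x i := ∑ k, forceCoeff o E μ i k • relPos o x k
  map_add' x x' := by
    funext i; simp only [relPos_add, smul_add, Finset.sum_add_distrib, Pi.add_apply]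
  map_smul' c x := by
    funext i
    simp only [relPos_smul, Pi.smul_apply, RingHom.id_apply, Finset.smul_sum]
    exact Finset.sum_congr rfl fun k _ => smul_comm _ _ _

theorem forceField_apply (E μ : Fin m → ℝ) (x : Config n) (i : Fin n) :
    forceField o E μ x i = ∑ k, forceCoeff o E μ i k • relPos o x k := rfl

theorem overallField_eq (d μ : Fin m → ℝ) (x : Config n) :
    overallField o d μ x = forceField o (err o d x) μ x := by
  funext i
  rw [overallField, forceField_apply, Finset.sum_filter, Finset.sum_filter, neg_add_eq_sub,
    ← Finset.sum_sub_distrib]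
  refine Finset.sum_congr rfl fun k _ => ?_
  rw [forceCoeff, sub_smul, ite_smul, ite_smul, zero_smul]

theorem inner_forceField (E μ : Fin m → ℝ) (x : Config n) (i : Fin n) (w : Plane) :
    inner ℝ (forceField o E μ x i) w
      = ∑ k, forceCoeff o E μ i k * inner ℝ (relPos o x k) w := by
  simp only [forceField_apply, sum_inner, inner_smul_left, RCLike.conj_to_real]

/-- Virtual work of the velocities given by `forceField`. -/
theorem sum_inner_forceField (E μ : Fin m → ℝ) (x u : Config n) :
    ∑ i, inner ℝ (forceField o E μ x i) (u i)
      = -∑ k, E k * rigMap o x u k + ∑ k, μ k * inner ℝ (relPos o x k) (u (o.tail k)) := by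
  simp only [inner_forceField]
  rw [Finset.sum_comm, ← Finset.sum_neg_distrib, ← Finset.sum_add_distrib]
  refine Finset.sum_congr rfl fun k _ => ?_
  simp only [forceCoeff, sub_mul, ite_mul, zero_mul, Finset.sum_sub_distrib, Finset.sum_ite_eq,
    Finset.mem_univ, if_true, rigMap_apply, inner_sub_right]
  ring

variable {o}

/-- The coefficients of the relative positions do not depend on `x` once the error is frozen. -/
theorem forceField_turn (E μ : Fin m → ℝ) {a b : ℝ} {v : Plane} {x x' : Config n}
    (h : ∀ l, x' l = turn a b (x l) + v) (i : Fin n) :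
    forceField o E μ x' i = turn a b (forceField o E μ x i) := by
  simp only [forceField_apply, relPos_turn h, map_sum, map_smul]

variable (o)

theorem incJ_eq (k : Fin m) (i : Fin n) : incJ o k i = if o.tail k = i then 1 else 0 := by
  have := o.head_ne_tail k
  unfold incJ incH
  by_cases h1 : i = o.head k
  · rw [if_pos h1, if_neg (h1 ▸ this.symm)]; simp
  · rw [if_neg h1]
    by_cases h2 : i = o.tail k
    · rw [if_pos h2, if_pos h2.symm]; simp
    · rw [if_neg h2, if_neg (Ne.symm h2)]; simp

theorem coords_forceField (E μ : Fin m → ℝ) (x : Config n) :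
    coords n (forceField o E μ x) = -((matR o x)ᵀ *ᵥ E) + (matS o x)ᵀ *ᵥ μ := by
  funext ic
  have h : ∀ k, forceCoeff o E μ ic.1 k * relPos o x k ic.2
      = -(matR o x k ic * E k) + matS o x k ic * μ k := by
    intro k
    have := o.head_ne_tail k
    rw [matR, matS, incJ_eq, incH, forceCoeff]
    by_cases h1 : o.tail k = ic.1 <;> by_cases h2 : o.head k = ic.1
    · exact absurd (h2.trans h1.symm) this
    all_goals
      simp only [h1, h2, eq_comm (a := ic.1), if_true, if_false]
      ring
  rw [coords_apply, forceField_apply]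
  simp only [Pi.add_apply, Pi.neg_apply, Matrix.mulVec, dotProduct, Matrix.transpose_apply,
    ← Finset.sum_neg_distrib, ← Finset.sum_add_distrib, ← h]
  simp

end Force

/-! ### The error system as the evolution of the reduced error -/

section AmbientSpace

variable {n m : ℕ} {G : SimpleGraph (Fin n)} {o : OrientedLabelling G m} {d : Fin m → ℝ}
  {T : Finset (Fin m)} {y : Config n} {A : Set (Config n)}

theorem redErr_target (hy : IsTargetFormation o d y) : redErr o d T y = 0 := by
  funext k; simp [redErr, err, hy.dist_eq]

theorem pointOf_mem {ε : {k // k ∈ T} → ℝ} (hε : ε ∈ redErr o d T '' A) :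
    pointOf o d T A ε ∈ A := Function.invFunOn_mem hε

theorem redErr_pointOf {ε : {k // k ∈ T} → ℝ} (hε : ε ∈ redErr o d T '' A) :
    redErr o d T (pointOf o d T A ε) = ε := Function.invFunOn_eq hε

namespace IsAmbientSpace

variable (hA : IsAmbientSpace o d T y A)
include hA

theorem inner_congr {x x' : Config n} (hx : x ∈ A) (hx' : x' ∈ A)
    (h : redErr o d T x = redErr o d T x') (i j k l : Fin n) :
    inner ℝ (x i - x j) (x k - x l) = inner ℝ (x' i - x' j) (x' k - x' l) := by
  obtain ⟨η, -, hη⟩ := hA.inner_eq i j k l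
  rw [hη x hx, hη x' hx', h]

theorem err_congr {x x' : Config n} (hx : x ∈ A) (hx' : x' ∈ A)
    (h : redErr o d T x = redErr o d T x') : err o d x = err o d x' := by
  funext k
  rw [err, err, relPos, relPos, ← real_inner_self_eq_norm_sq, ← real_inner_self_eq_norm_sq,
    hA.inner_congr hx hx' h]

/-- By minimal rigidity the reduced error is a submersion on `A`, hence open. Openness makes
`fderiv` of `psi` a genuine derivative at every point of the image. -/
theorem isOpen_image (hn : 3 ≤ n) : IsOpen (redErr o d T '' A) := by
  rw [isOpen_iff_mem_nhds]
  rintro _ ⟨x, hx, rfl⟩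
  have hd := (contDiff_redErr o d T).contDiffAt.hasStrictFDerivAt' (hasFDerivAt_redErr o d T x)
    (by simp)
  have hs := ((subMinInfRigid_iff hn).1 (hA.minInfRigid x hx)).1
  rw [← hd.map_nhds_eq_of_surj]
  · exact Filter.image_mem_map (hA.isOpen.mem_nhds hx)
  · rw [LinearMap.range_eq_top]
    intro c
    obtain ⟨u, hu⟩ := hs ((2 : ℝ)⁻¹ • c)
    refine ⟨u, ?_⟩
    change (2 : ℝ) • redRigMap o T x u = c
    rw [hu, smul_smul]; norm_num

theorem contDiffOn_inner_pointOf (i j k l : Fin n) :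
    ContDiffOn ℝ ∞ (fun ε => inner ℝ (pointOf o d T A ε i - pointOf o d T A ε j)
      (pointOf o d T A ε k - pointOf o d T A ε l)) (redErr o d T '' A) := by
  obtain ⟨η, hs, hη⟩ := hA.inner_eq i j k l
  refine hs.congr fun ε hε => ?_
  rw [hη _ (pointOf_mem hε), redErr_pointOf hε]

theorem contDiffOn_psi : ContDiffOn ℝ ∞ (psi o d T A) (redErr o d T '' A) := by
  refine contDiffOn_pi.2 fun k => ?_
  simp only [psi, err, ← real_inner_self_eq_norm_sq]
  exact (hA.contDiffOn_inner_pointOf _ _ _ _).sub contDiffOn_const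

theorem psi_redErr {x : Config n} (hx : x ∈ A) (k : {k // k ∉ T}) :
    psi o d T A (redErr o d T x) k = err o d x k :=
  congrFun (hA.err_congr (pointOf_mem ⟨x, hx, rfl⟩) hx (redErr_pointOf ⟨x, hx, rfl⟩)) k

theorem eqOutput_redErr {x : Config n} (hx : x ∈ A) :
    eqOutput o d T A (redErr o d T x) = err o d x := by
  funext k
  unfold eqOutput
  split_ifs with h
  · rfl
  · exact hA.psi_redErr hx ⟨k, h⟩

theorem contDiffOn_eqOutput : ContDiffOn ℝ ∞ (eqOutput o d T A) (redErr o d T '' A) := by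
  refine contDiffOn_pi.2 fun k => ?_
  unfold eqOutput
  split_ifs with h
  · exact (contDiff_apply ℝ ℝ (⟨k, h⟩ : {k // k ∈ T})).contDiffOn
  · exact contDiffOn_pi.1 hA.contDiffOn_psi ⟨k, h⟩

/-- The edges outside `T` contribute to the rigidity map through the Jacobian matrix of `ψ`. -/
theorem rigMap_eq_psiJac (hn : 3 ≤ n) {x : Config n} (hx : x ∈ A) (u : Config n)
    (k : {k // k ∉ T}) :
    rigMap o x u k = (psiJac o d T A (redErr o d T x) *ᵥ redRigMap o T x u) k := by
  have hmem : redErr o d T x ∈ redErr o d T '' A := ⟨x, hx, rfl⟩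
  have hψ : HasFDerivAt (psi o d T A) _ (redErr o d T x) :=
    ((hA.contDiffOn_psi.contDiffAt ((hA.isOpen_image hn).mem_nhds hmem)).differentiableAt
      (by simp)).hasFDerivAt
  have h1 := hasFDerivAt_pi'.1 (hψ.comp x (hasFDerivAt_redErr o d T x)) k
  have h2 := (hasFDerivAt_err o d x k).congr_of_eventuallyEq
    (Filter.eventually_of_mem (hA.isOpen.mem_nhds hx) fun x' hx' => hA.psi_redErr hx' k)
  have h3 := congrArg (fun L : Config n →L[ℝ] ℝ => L u) (h2.unique h1)
  have h4 : (2 : ℝ) * rigMap o x u k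
      = fderiv ℝ (psi o d T A) (redErr o d T x) ((2 : ℝ) • redRigMap o T x u) k := h3
  rw [map_smul, Pi.smul_apply, smul_eq_mul] at h4
  rw [psiJac, LinearMap.toMatrix'_mulVec]
  exact mul_left_cancel₀ two_ne_zero h4

end IsAmbientSpace

variable (o d T A) in
/-- The vector `ε + F'(ε) ψ(ε)`. -/
noncomputable def redStress (ε : {k // k ∈ T} → ℝ) : {k // k ∈ T} → ℝ :=
  ε + (psiJac o d T A ε)ᵀ *ᵥ psi o d T A ε

theorem errorField_eq (ε : {k // k ∈ T} → ℝ) (μ : Fin m → ℝ) :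
    errorField o d T A ε μ
      = (-2 : ℝ) • ((matRred o T (pointOf o d T A ε) * (matRred o T (pointOf o d T A ε))ᵀ)
          *ᵥ redStress o d T A ε)
        + (2 : ℝ) • ((matRred o T (pointOf o d T A ε) * (matS o (pointOf o d T A ε))ᵀ) *ᵥ μ) := by
  rw [errorField, redStress, Matrix.mulVec_add, Matrix.mulVec_mulVec, smul_add]
  simp only [neg_smul]
  rw [← sub_eq_add_neg]

theorem matRred_mulVec (x u : Config n) : matRred o T x *ᵥ coords n u = redRigMap o T x u := by
  funext k; exact congrFun (matR_mulVec o x u) k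

/-- The rows of `R` outside `T` are `F R̃`, so `R'e = R̃'(ε + F'ψ)`. The identity is tested against
an arbitrary velocity `u`. -/
theorem IsAmbientSpace.transpose_matR_mulVec (hA : IsAmbientSpace o d T y A) (hn : 3 ≤ n)
    {x : Config n} (hx : x ∈ A) :
    (matR o x)ᵀ *ᵥ err o d x = (matRred o T x)ᵀ *ᵥ redStress o d T A (redErr o d T x) := by
  classical
  apply dotProduct_eq
  intro v
  obtain ⟨u, rfl⟩ := (coords n).surjective v
  rw [Matrix.mulVec_transpose, Matrix.mulVec_transpose, ← Matrix.dotProduct_mulVec,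
    ← Matrix.dotProduct_mulVec, matR_mulVec, matRred_mulVec, redStress, add_dotProduct,
    Matrix.mulVec_transpose, ← Matrix.dotProduct_mulVec]
  simp only [dotProduct]
  rw [← Fintype.sum_subtype_add_sum_subtype (fun k => k ∈ T)]
  -- The sums on the two sides carry different `Fintype` instances on the same subtypes.
  have huniv : ∀ (S : Type) (i j : Fintype S), @Finset.univ S i = @Finset.univ S j :=
    fun S i j => congrArg (fun i => @Finset.univ S i) (Subsingleton.elim i j)
  refine congrArg₂ _ (Finset.sum_congr (huniv _ _ _) fun k _ => rfl)
    (Finset.sum_congr (huniv _ _ _) fun k _ => ?_)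
  rw [hA.psi_redErr hx, hA.rigMap_eq_psiJac hn hx]

/-- The error field is the derivative of the reduced error along the overall field. -/
theorem IsAmbientSpace.errorField_eq_redRigMap (hA : IsAmbientSpace o d T y A) (hn : 3 ≤ n)
    {ε : {k // k ∈ T} → ℝ} (hε : ε ∈ redErr o d T '' A) (μ : Fin m → ℝ) :
    errorField o d T A ε μ = (2 : ℝ) • redRigMap o T (pointOf o d T A ε)
      (forceField o (err o d (pointOf o d T A ε)) μ (pointOf o d T A ε)) := by
  rw [errorField_eq, ← matRred_mulVec, coords_forceField,
    hA.transpose_matR_mulVec hn (pointOf_mem hε), redErr_pointOf hε, Matrix.mulVec_add,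
    Matrix.mulVec_neg, Matrix.mulVec_mulVec, Matrix.mulVec_mulVec]
  module

end AmbientSpace

end Formation

/-! ### The branch of equilibria -/

namespace Formation

open scoped ContDiff Topology Matrix

/-- Where one factor vanishes, the derivative of the other is irrelevant. This spares every
derivative of `R̃R̃'`, of `F` and of the inner products below. -/
theorem hasDerivAt_mul_of_right_eq_zero {a b : ℝ → ℝ} {b' t : ℝ} (ha : DifferentiableAt ℝ a t)
    (hb : HasDerivAt b b' t) (h0 : b t = 0) : HasDerivAt (fun s => a s * b s) (a t * b') t := by
  have := ha.hasDerivAt.mul hb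
  rwa [h0, mul_zero, zero_add] at this

theorem hasDerivAt_comp_smul {E F : Type*} [NormedAddCommGroup E] [NormedSpace ℝ E]
    [NormedAddCommGroup F] [NormedSpace ℝ F] {f : E → F} (hf : DifferentiableAt ℝ f 0) (v : E) :
    HasDerivAt (fun t : ℝ => f (t • v)) (fderiv ℝ f 0 v) 0 := by
  have h1 : HasDerivAt (fun t : ℝ => t • v) v 0 := by
    simpa using (hasDerivAt_id (0 : ℝ)).smul_const v
  have h2 : HasFDerivAt f (fderiv ℝ f 0) ((0 : ℝ) • v) := by rw [zero_smul]; exact hf.hasFDerivAt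
  exact h2.comp_hasDerivAt 0 h1

section Branch

variable {n m : ℕ} {G : SimpleGraph (Fin n)} {o : OrientedLabelling G m} {d : Fin m → ℝ}
  {T : Finset (Fin m)} {y : Config n} {A : Set (Config n)}

/-- The chosen representative `pointOf` need not depend continuously on `ε`. The entries of `R̃R̃'`
and `R̃S'` are nevertheless smooth, because they involve it only through inner products. -/
theorem sum_mul_relPos (a b : Matrix (Fin m) (Fin n) ℝ) (x : Config n) (k p : Fin m) :
    ∑ ic : Fin n × Fin 2, a k ic.1 * relPos o x k ic.2 * (b p ic.1 * relPos o x p ic.2)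
      = (∑ i, a k i * b p i) * inner ℝ (relPos o x k) (relPos o x p) := by
  rw [Fintype.sum_prod_type, Finset.sum_mul]
  refine Finset.sum_congr rfl fun i _ => ?_
  rw [Fin.sum_univ_two, plane_inner]; ring

/-- From `R̃R̃'w = 0` follows `‖R̃'w‖² = 0`; writing `w = R̃u` then gives `‖w‖² = ⟨R̃'w, u⟩ = 0`. -/
theorem transpose_matRred_injective {x : Config n} (hs : Function.Surjective (redRigMap o T x))
    {w : {k // k ∈ T} → ℝ} (hw : (matRred o T x * (matRred o T x)ᵀ) *ᵥ w = 0) : w = 0 := by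
  have h1 : (matRred o T x)ᵀ *ᵥ w = 0 := by
    apply dotProduct_self_eq_zero.1
    rw [Matrix.mulVec_transpose, ← Matrix.dotProduct_mulVec, ← Matrix.mulVec_transpose,
      Matrix.mulVec_mulVec, hw, dotProduct_zero]
  obtain ⟨u, rfl⟩ := hs w
  apply dotProduct_self_eq_zero.1
  nth_rewrite 2 [← matRred_mulVec]
  rw [Matrix.dotProduct_mulVec, ← Matrix.mulVec_transpose, h1, zero_dotProduct]

namespace IsAmbientSpace

variable (hA : IsAmbientSpace o d T y A)
include hA

theorem contDiffOn_matRred_mul (k l : {k // k ∈ T}) :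
    ContDiffOn ℝ ∞ (fun ε => (matRred o T (pointOf o d T A ε) *
      (matRred o T (pointOf o d T A ε))ᵀ) k l) (redErr o d T '' A) := by
  have h : ∀ ε, (matRred o T (pointOf o d T A ε) * (matRred o T (pointOf o d T A ε))ᵀ) k l
      = (∑ i, incH o k i * incH o l i) * inner ℝ (relPos o (pointOf o d T A ε) k)
        (relPos o (pointOf o d T A ε) l) := fun ε => sum_mul_relPos _ _ _ _ _
  simp only [h]
  exact contDiffOn_const.mul (hA.contDiffOn_inner_pointOf _ _ _ _)

theorem contDiffOn_matRred_mul_matS (k : {k // k ∈ T}) (l : Fin m) :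
    ContDiffOn ℝ ∞ (fun ε => (matRred o T (pointOf o d T A ε) *
      (matS o (pointOf o d T A ε))ᵀ) k l) (redErr o d T '' A) := by
  have h : ∀ ε, (matRred o T (pointOf o d T A ε) * (matS o (pointOf o d T A ε))ᵀ) k l
      = (∑ i, incH o k i * incJ o l i) * inner ℝ (relPos o (pointOf o d T A ε) k)
        (relPos o (pointOf o d T A ε) l) := fun ε => sum_mul_relPos _ _ _ _ _
  simp only [h]
  exact contDiffOn_const.mul (hA.contDiffOn_inner_pointOf _ _ _ _)

theorem contDiffOn_psiJac (hn : 3 ≤ n) (p : {k // k ∉ T}) (l : {k // k ∈ T}) :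
    ContDiffOn ℝ ∞ (fun ε => psiJac o d T A ε p l) (redErr o d T '' A) := by
  simp only [psiJac, LinearMap.toMatrix'_apply]
  have h := (hA.contDiffOn_psi.fderiv_of_isOpen (hA.isOpen_image hn)
    (m := ∞) (by simp)).clm_apply (contDiffOn_const (c := Pi.single l (1 : ℝ)))
  exact contDiffOn_pi.1 h p

theorem contDiffOn_redStress (hn : 3 ≤ n) :
    ContDiffOn ℝ ∞ (redStress o d T A) (redErr o d T '' A) := by
  refine contDiffOn_pi.2 fun l => ?_
  refine (contDiff_apply ℝ ℝ l).contDiffOn.add ?_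
  simp only [Matrix.mulVec, dotProduct, Matrix.transpose_apply]
  exact ContDiffOn.sum fun p _ =>
    (hA.contDiffOn_psiJac hn p l).mul (contDiffOn_pi.1 hA.contDiffOn_psi p)

theorem contDiffOn_errorField (hn : 3 ≤ n) :
    ContDiffOn ℝ ∞ (fun p : ({k // k ∈ T} → ℝ) × (Fin m → ℝ) => errorField o d T A p.1 p.2)
      ((redErr o d T '' A) ×ˢ Set.univ) := by
  have hfst : ∀ {f : ({k // k ∈ T} → ℝ) → ℝ}, ContDiffOn ℝ ∞ f (redErr o d T '' A) →
      ContDiffOn ℝ ∞ (fun p : ({k // k ∈ T} → ℝ) × (Fin m → ℝ) => f p.1)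
        ((redErr o d T '' A) ×ˢ Set.univ) := fun hf =>
    ContDiffOn.comp (f := fun p : ({k // k ∈ T} → ℝ) × (Fin m → ℝ) => p.1) hf
      contDiff_fst.contDiffOn fun p hp => hp.1
  refine contDiffOn_pi.2 fun k => ?_
  simp only [errorField_eq, Pi.add_apply, Pi.smul_apply, Matrix.mulVec, dotProduct,
    smul_eq_mul]
  have h1 : ContDiffOn ℝ ∞ (fun p : ({k // k ∈ T} → ℝ) × (Fin m → ℝ) =>
      ∑ l, (matRred o T (pointOf o d T A p.1) * (matRred o T (pointOf o d T A p.1))ᵀ) k l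
        * redStress o d T A p.1 l) ((redErr o d T '' A) ×ˢ Set.univ) :=
    ContDiffOn.sum fun l _ => (hfst (hA.contDiffOn_matRred_mul k l)).mul
      (hfst (contDiffOn_pi.1 (hA.contDiffOn_redStress hn) l))
  have h2 : ContDiffOn ℝ ∞ (fun p : ({k // k ∈ T} → ℝ) × (Fin m → ℝ) =>
      ∑ l, (matRred o T (pointOf o d T A p.1) * (matS o (pointOf o d T A p.1))ᵀ) k l * p.2 l)
        ((redErr o d T '' A) ×ˢ Set.univ) := by
    refine ContDiffOn.sum fun l _ => (hfst (hA.contDiffOn_matRred_mul_matS k l)).mul ?_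
    have hl : ContDiff ℝ ∞ fun p : ({k // k ∈ T} → ℝ) × (Fin m → ℝ) => p.2 l := by fun_prop
    exact hl.contDiffOn
  exact (contDiffOn_const.mul h1).add (contDiffOn_const.mul h2)

theorem zero_mem (hy : IsTargetFormation o d y) : 0 ∈ redErr o d T '' A :=
  ⟨y, hA.mem, redErr_target hy⟩

theorem eqOutput_zero (hy : IsTargetFormation o d y) : eqOutput o d T A 0 = 0 := by
  rw [← redErr_target (T := T) hy, hA.eqOutput_redErr hA.mem]
  funext k; simp [err, hy.dist_eq]

theorem psi_zero (hy : IsTargetFormation o d y) : psi o d T A 0 = 0 := by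
  funext k
  rw [← redErr_target (T := T) hy, hA.psi_redErr hA.mem]
  simp [err, hy.dist_eq]

theorem redStress_zero (hy : IsTargetFormation o d y) : redStress o d T A 0 = 0 := by
  rw [redStress, hA.psi_zero hy, Matrix.mulVec_zero, add_zero]

/-- Since `ψ(0) = 0`, the derivative of `F` does not contribute and the linearization is `I + F'F`.
-/
theorem hasDerivAt_redStress (hn : 3 ≤ n) (hy : IsTargetFormation o d y)
    (v : {k // k ∈ T} → ℝ) (l : {k // k ∈ T}) :
    HasDerivAt (fun t : ℝ => redStress o d T A (t • v) l)
      ((v + (psiJac o d T A 0)ᵀ *ᵥ (psiJac o d T A 0 *ᵥ v)) l) 0 := by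
  have hnhds := (hA.isOpen_image hn).mem_nhds (hA.zero_mem hy)
  have h0 : HasDerivAt (fun t : ℝ => t * v l) (v l) 0 := by
    simpa using (hasDerivAt_id (0 : ℝ)).mul_const (v l)
  refine h0.add ?_
  simp only [Matrix.mulVec, dotProduct, Matrix.transpose_apply]
  refine HasDerivAt.fun_sum fun p _ => ?_
  have h1 := (hasDerivAt_comp_smul (((hA.contDiffOn_psiJac hn p l).contDiffAt
    hnhds).differentiableAt (by simp)) v).differentiableAt
  have h2 := hasDerivAt_pi.1 (hasDerivAt_comp_smul ((hA.contDiffOn_psi.contDiffAt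
    hnhds).differentiableAt (by simp)) v) p
  convert! hasDerivAt_mul_of_right_eq_zero h1 h2 (by rw [zero_smul, hA.psi_zero hy]; rfl) using 1
  rw [zero_smul]
  congr 1
  rw [psiJac]
  exact congrFun (LinearMap.toMatrix'_mulVec _ v) p

theorem hasDerivAt_errorField (hn : 3 ≤ n) (hy : IsTargetFormation o d y)
    (v : {k // k ∈ T} → ℝ) :
    HasDerivAt (fun t : ℝ => errorField o d T A (t • v) 0)
      ((-2 : ℝ) • ((matRred o T (pointOf o d T A 0) * (matRred o T (pointOf o d T A 0))ᵀ)
          *ᵥ (v + (psiJac o d T A 0)ᵀ *ᵥ (psiJac o d T A 0 *ᵥ v)))) 0 := by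
  have hnhds := (hA.isOpen_image hn).mem_nhds (hA.zero_mem hy)
  rw [hasDerivAt_pi]
  intro k
  simp only [errorField_eq, Matrix.mulVec_zero, smul_zero, add_zero, Pi.smul_apply, smul_eq_mul]
  refine HasDerivAt.const_mul _ ?_
  simp only [Matrix.mulVec, dotProduct]
  refine HasDerivAt.fun_sum fun l _ => ?_
  have h1 := (hasDerivAt_comp_smul (((hA.contDiffOn_matRred_mul k l).contDiffAt
    hnhds).differentiableAt (by simp)) v).differentiableAt
  convert! hasDerivAt_mul_of_right_eq_zero h1 (hA.hasDerivAt_redStress hn hy v l)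
    (by rw [zero_smul, hA.redStress_zero hy]; rfl) using 1
  rw [zero_smul]

/-- The implicit function theorem, obtained by inverting `(ε, μ) ↦ (g(ε, μ), μ)` near `0` and
restricting the inverse to `(0, μ)`. Injectivity of the differential reduces to `(I + F'F)v = 0`,
which gives `‖v‖² + ‖Fv‖² = 0`. -/
theorem exists_isEquilibriumBranch (hn : 3 ≤ n) (hy : IsTargetFormation o d y) :
    ∃ M ε, IsEquilibriumBranch o d T A M ε := by
  have hW := hA.isOpen_image hn
  have h0 := hA.zero_mem hy
  have hg := hA.contDiffOn_errorField hn
  have hf : ContDiffOn ℝ ∞ (fun p : ({k // k ∈ T} → ℝ) × (Fin m → ℝ) =>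
      (errorField o d T A p.1 p.2, p.2)) ((redErr o d T '' A) ×ˢ Set.univ) :=
    hg.prodMk contDiff_snd.contDiffOn
  have hs : IsOpen ((redErr o d T '' A) ×ˢ (Set.univ : Set (Fin m → ℝ))) := hW.prod isOpen_univ
  have hmem : (0 : ({k // k ∈ T} → ℝ) × (Fin m → ℝ)) ∈ (redErr o d T '' A) ×ˢ Set.univ :=
    ⟨h0, Set.mem_univ _⟩
  have hgd := (hg.contDiffAt (hs.mem_nhds hmem)).differentiableAt (by simp)
  obtain ⟨e, he0, hsrc, he, hsymm, -⟩ := exists_smooth_local_inverse rfl hs hf hmem (by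
    rintro ⟨v, w⟩ hvw
    rw [(hgd.hasFDerivAt.prodMk hasFDerivAt_snd).fderiv] at hvw
    obtain ⟨h1, h2⟩ := Prod.mk_eq_zero.1 hvw
    have hw : w = 0 := h2
    subst hw
    have h3 := hasDerivAt_comp_smul hgd (v, (0 : Fin m → ℝ))
    replace h1 : fderiv ℝ (fun p : ({k // k ∈ T} → ℝ) × (Fin m → ℝ) =>
      errorField o d T A p.1 p.2) 0 (v, 0) = 0 := h1
    rw [h1] at h3
    simp only [Prod.smul_mk, smul_zero] at h3
    have h4 := (hA.hasDerivAt_errorField hn hy v).unique h3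
    have h5 := transpose_matRred_injective ((subMinInfRigid_iff hn).1
      (hA.minInfRigid _ (pointOf_mem h0))).1 ((smul_eq_zero.1 h4).resolve_left (by norm_num))
    have h6 : v ⬝ᵥ v + (psiJac o d T A 0 *ᵥ v) ⬝ᵥ (psiJac o d T A 0 *ᵥ v) = 0 := by
      have := congrArg (fun z => v ⬝ᵥ z) h5
      simp only [dotProduct_add, dotProduct_zero] at this
      rwa [Matrix.dotProduct_mulVec v, Matrix.vecMul_transpose] at this
    have h7 : v ⬝ᵥ v = 0 := by
      have ha : 0 ≤ v ⬝ᵥ v := Finset.sum_nonneg fun i _ => mul_self_nonneg _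
      have hb : 0 ≤ (psiJac o d T A 0 *ᵥ v) ⬝ᵥ (psiJac o d T A 0 *ᵥ v) :=
        Finset.sum_nonneg fun i _ => mul_self_nonneg _
      linarith
    rw [dotProduct_self_eq_zero.1 h7]; rfl)
  have hg0 : errorField o d T A 0 0 = 0 := by
    rw [errorField_eq, hA.redStress_zero hy]; simp
  have hcont : ContDiff ℝ ∞ fun μ : Fin m → ℝ => ((0 : {k // k ∈ T} → ℝ), μ) :=
    contDiff_const.prodMk contDiff_id
  have hval : ∀ μ, ((0 : {k // k ∈ T} → ℝ), μ) ∈ e.target →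
      e.symm (0, μ) ∈ e.source ∧ (e.symm (0, μ)).2 = μ ∧
        errorField o d T A (e.symm (0, μ)).1 μ = 0 := by
    intro μ hμ
    have h := e.right_inv hμ
    rw [he] at h
    obtain ⟨h1, h2⟩ := Prod.mk.inj h
    exact ⟨e.map_target hμ, h2, by rwa [h2] at h1⟩
  have he00 : e 0 = (0, 0) := by rw [he]; exact Prod.ext hg0 rfl
  refine ⟨(fun μ => (0, μ)) ⁻¹' e.target, fun μ => (e.symm (0, μ)).1,
    e.open_target.preimage hcont.continuous, ?_, ?_, ?_, ?_, ?_⟩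
  · rw [Set.mem_preimage, ← he00]; exact e.map_source he0
  · exact (contDiff_fst.comp_contDiffOn hsymm).comp hcont.contDiffOn fun μ hμ => hμ
  · rw [← he00, e.left_inv he0]; rfl
  · exact fun μ hμ => (hsrc (hval μ hμ).1).1
  · exact fun μ hμ => (hval μ hμ).2.2

end IsAmbientSpace

end Branch

end Formation

/-! ### Rigid motions as equilibrium solutions -/

namespace Formation

open scoped ContDiff Topology Matrix

theorem quarterTurn_quarterTurn (p : Plane) : quarterTurn (quarterTurn p) = -p := by
  apply plane_ext <;> simp

theorem rot_zero (p : Plane) : rot 0 p = p := by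
  rw [rot_eq_turn]; simp [turn]

theorem hasDerivAt_rot (w t : ℝ) (p : Plane) :
    HasDerivAt (fun t => rot (w * t) p) (rot (w * t) (w • quarterTurn p)) t := by
  have hm : HasDerivAt (fun t : ℝ => w * t) w t := by
    simpa using (hasDerivAt_id t).const_mul w
  have h := (hm.cos.smul_const p).add (hm.sin.smul_const (quarterTurn p))
  have hfun : (fun t => rot (w * t) p)
      = (fun t => Real.cos (w * t) • p) + fun t => Real.sin (w * t) • quarterTurn p := by
    funext t; rw [rot_eq_turn]; rfl
  rw [hfun]
  convert! h using 1
  rw [rot_eq_turn, map_smul]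
  simp only [turn, LinearMap.add_apply, LinearMap.smul_apply, LinearMap.id_apply,
    quarterTurn_quarterTurn]
  module

section Motion

variable {n m : ℕ} {G : SimpleGraph (Fin n)} {o : OrientedLabelling G m} {d : Fin m → ℝ}
  {T : Finset (Fin m)} {y : Config n} {A : Set (Config n)}

/-- The motion of the plane with initial velocity field `p ↦ a + w • quarterTurn p`: a
translation if `w = 0`, and a rotation otherwise. -/
noncomputable def rigidMotion (a : Plane) (w t : ℝ) (p : Plane) : Plane :=
  if w = 0 then p + t • a
  else w⁻¹ • quarterTurn a + rot (w * t) (p - w⁻¹ • quarterTurn a)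

theorem rigidMotion_zero (a : Plane) (w : ℝ) (p : Plane) : rigidMotion a w 0 p = p := by
  unfold rigidMotion; split_ifs <;> simp [rot_zero]

theorem rigidMotion_eq (a : Plane) (w t : ℝ) :
    ∃ v, ∀ p, rigidMotion a w t p = rot (w * t) p + v := by
  by_cases hw : w = 0
  · exact ⟨t • a, fun p => by simp [rigidMotion, hw, rot_zero]⟩
  · refine ⟨w⁻¹ • quarterTurn a - rot (w * t) (w⁻¹ • quarterTurn a), fun p => ?_⟩
    simp only [rigidMotion, hw, if_false, rot_eq_turn, map_sub]
    abel

theorem hasDerivAt_rigidMotion (a : Plane) (w t : ℝ) (p : Plane) :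
    HasDerivAt (fun t => rigidMotion a w t p) (rot (w * t) (a + w • quarterTurn p)) t := by
  by_cases hw : w = 0
  · simp only [rigidMotion, hw, if_true, zero_mul, rot_zero, zero_smul, add_zero]
    simpa using ((hasDerivAt_id t).smul_const a).const_add p
  · simp only [rigidMotion, hw, if_false]
    -- The centre `w⁻¹ • quarterTurn a` is the zero of the velocity field: `a + w J p = w J (p - w⁻¹
    -- J a)`.
    convert! (hasDerivAt_rot w t (p - w⁻¹ • quarterTurn a)).const_add _ using 2
    rw [map_sub, map_smul, quarterTurn_quarterTurn, smul_sub, smul_smul, mul_inv_cancel₀ hw]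
    module

/-- If the velocities at `x₀` are those of an infinitesimal rigid motion, then the overall system
with frozen error moves `x₀` by the corresponding rigid motion. -/
theorem hasDerivAt_rigidMotion_forceField {E μ : Fin m → ℝ} {x₀ : Config n} {a : Plane} {w : ℝ}
    (h : ∀ i, forceField o E μ x₀ i = a + w • quarterTurn (x₀ i)) (t : ℝ) :
    HasDerivAt (fun t i => rigidMotion a w t (x₀ i))
      (forceField o E μ fun i => rigidMotion a w t (x₀ i)) t := by
  rw [hasDerivAt_pi]
  intro i
  convert! hasDerivAt_rigidMotion a w t (x₀ i) using 1
  obtain ⟨v, hv⟩ := rigidMotion_eq a w t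
  simp only [rot_eq_turn] at hv
  rw [forceField_turn E μ (fun l => hv (x₀ l)) i, h i, rot_eq_turn]

theorem err_rigidMotion (x₀ : Config n) (a : Plane) (w t : ℝ) :
    err o d (fun i => rigidMotion a w t (x₀ i)) = err o d x₀ := by
  obtain ⟨v, hv⟩ := rigidMotion_eq a w t
  simp only [rot_eq_turn] at hv
  exact err_turn (sq_add_sq_cos_sin _) fun l => hv (x₀ l)

namespace IsAmbientSpace

variable (hA : IsAmbientSpace o d T y A)
include hA

/-- At a point whose reduced error is an equilibrium of the error system the velocities are those
of an infinitesimal rigid motion. -/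
theorem exists_forceField_eq (hn : 3 ≤ n) {μ : Fin m → ℝ} {x₀ : Config n} (hx : x₀ ∈ A)
    (h : errorField o d T A (redErr o d T x₀) μ = 0) :
    ∃ (a : Plane) (w : ℝ), ∀ i,
      forceField o (err o d x₀) μ x₀ i = a + w • quarterTurn (x₀ i) := by
  have hε : redErr o d T x₀ ∈ redErr o d T '' A := ⟨x₀, hx, rfl⟩
  have hp := pointOf_mem hε
  have hr := redErr_pointOf hε
  rw [hA.errorField_eq_redRigMap hn hε, hA.err_congr hp hx hr] at h
  refine (hA.minInfRigid x₀ hx).1.exists_trivial hn fun k hk => ?_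
  have h0 := congrFun ((smul_eq_zero.1 h).resolve_left two_ne_zero) ⟨k, hk⟩
  simp only [redRigMap_apply, Pi.zero_apply] at h0
  -- `h0` holds at the chosen representative. Both sides expand into inner products of relative
  -- positions, which agree at `x₀`.
  rw [rigMap_apply, ← h0, real_inner_comm, real_inner_comm _ (relPos o (pointOf o d T A _) k),
    inner_sub_left, inner_sub_left]
  simp only [inner_forceField, relPos, hA.inner_congr hp hx hr]

theorem isEquilibriumSolution_rigidMotion {μ : Fin m → ℝ} {x₀ : Config n} (hx : x₀ ∈ A)
    {a : Plane} {w : ℝ}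
    (h : ∀ i, forceField o (err o d x₀) μ x₀ i = a + w • quarterTurn (x₀ i)) :
    IsEquilibriumSolution o d A μ (err o d x₀) fun t i => rigidMotion a w t (x₀ i) where
  hasDeriv t _ := by
    rw [overallField_eq, err_rigidMotion]
    exact (hasDerivAt_rigidMotion_forceField h t).hasDerivWithinAt
  mem t _ := by
    obtain ⟨v, hv⟩ := rigidMotion_eq a w t
    simp only [hv]
    exact hA.invariant x₀ hx _ v
  err_eq t _ := err_rigidMotion _ _ _ _

end IsAmbientSpace

/-- Along an equilibrium solution the error is constant, so the nonlinear system becomes a linear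
one with a global Lipschitz constant and uniqueness applies. -/
theorem IsEquilibriumSolution.eq_rigidMotion {μ E : Fin m → ℝ} {x : ℝ → Config n}
    (hx : IsEquilibriumSolution o d A μ E x) {a : Plane} {w : ℝ}
    (h : ∀ i, forceField o E μ (x 0) i = a + w • quarterTurn (x 0 i)) {t : ℝ} (ht : 0 ≤ t)
    (i : Fin n) : x t i = rigidMotion a w t (x 0 i) := by
  let L : Config n →L[ℝ] Config n := (forceField o E μ).toContinuousLinearMap
  have hd : ∀ s, 0 ≤ s → HasDerivWithinAt x (L (x s)) (Set.Ici 0) s := fun s hs => by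
    have := hx.hasDeriv s hs
    rwa [overallField_eq, hx.err_eq s hs] at this
  have hg := fun s => hasDerivAt_rigidMotion_forceField (o := o) (E := E) (μ := μ) h s
  have := ODE_solution_unique (v := fun _ => L) (K := ‖L‖₊) (f := x)
    (g := fun t i => rigidMotion a w t (x 0 i)) (a := 0) (b := t) (fun _ => L.lipschitz)
    (fun s hs => ((hd s hs.1).mono Set.Icc_subset_Ici_self).continuousWithinAt)
    (fun s hs => (hd s hs.1).mono (Set.Ici_subset_Ici.2 hs.1))
    (fun s _ => (hg s).continuousAt.continuousWithinAt)
    (fun s _ => (hg s).hasDerivWithinAt)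
    (by funext i; rw [rigidMotion_zero]) (Set.right_mem_Icc.2 ht)
  exact congrFun this i

variable {x : ℝ → Config n} {a : Plane} {w : ℝ}

theorem not_relPosConst_of_rigidMotion (hw : w ≠ 0) {k : Fin m} (hk : relPos o (x 0) k ≠ 0)
    (h : ∀ t, 0 ≤ t → ∀ i, x t i = rigidMotion a w t (x 0 i)) : ¬ RelPosConst o x := by
  intro hc
  -- After half a turn every relative position has changed sign.
  have ht : 0 ≤ Real.pi / |w| := by positivity
  have h1 := congrFun (hc _ ht) k
  obtain ⟨v, hv⟩ := rigidMotion_eq a w (Real.pi / |w|)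
  simp only [rot_eq_turn] at hv
  rw [relPos_turn (fun l => (h _ ht l).trans (hv _)) k] at h1
  have hcos : Real.cos (w * (Real.pi / |w|)) = -1 ∧ Real.sin (w * (Real.pi / |w|)) = 0 := by
    rcases lt_or_gt_of_ne hw with h | h
    · rw [abs_of_neg h, show w * (Real.pi / -w) = -Real.pi by field_simp]; simp
    · rw [abs_of_pos h, show w * (Real.pi / w) = Real.pi by field_simp]; simp
  rw [hcos.1, hcos.2] at h1
  simp only [turn, neg_smul, one_smul, zero_smul, add_zero, LinearMap.neg_apply,
    LinearMap.id_apply] at h1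
  have h2 : (2 : ℝ) • relPos o (x 0) k = 0 := by
    rw [two_smul]; nth_rewrite 1 [← h1]; exact neg_add_cancel _
  exact hk ((smul_eq_zero.1 h2).resolve_left two_ne_zero)

theorem rotatesAbout_of_rigidMotion (hw : w ≠ 0)
    (h : ∀ t, 0 ≤ t → ∀ i, x t i = rigidMotion a w t (x 0 i)) :
    RotatesAbout x |w| (SignType.sign w) (w⁻¹ • quarterTurn a) := by
  refine ⟨abs_pos.2 hw, ?_, fun t ht i => ?_⟩
  · rcases lt_or_gt_of_ne hw with h | h <;> simp [h]
  · rw [h t ht i, rigidMotion, if_neg hw, sign_mul_abs]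

theorem stationary_of_rigidMotion
    (h : ∀ t, 0 ≤ t → ∀ i, x t i = rigidMotion 0 0 t (x 0 i)) : Stationary x :=
  fun t ht => funext fun i => by simp [h t ht i, rigidMotion]

theorem drifts_of_rigidMotion (ha : a ≠ 0)
    (h : ∀ t, 0 ≤ t → ∀ i, x t i = rigidMotion a 0 t (x 0 i)) : Drifts x := by
  have h' : ∀ i t, 0 ≤ t → x t i = x 0 i + t • a := fun i t ht => by
    rw [h t ht i, rigidMotion, if_pos rfl]
  refine ⟨a, ha, fun i => ⟨h' i, ?_⟩⟩
  have h1 : Filter.Tendsto (fun t : ℝ => t * ‖a‖ - ‖x 0 i‖) Filter.atTop Filter.atTop :=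
    Filter.tendsto_atTop_add_const_right _ _
      (Filter.tendsto_id.atTop_mul_const (norm_pos_iff.2 ha))
  refine Filter.tendsto_atTop_mono' _ ?_ h1
  filter_upwards [Filter.eventually_ge_atTop 0] with t ht
  rw [h' i t ht]
  have h2 := norm_sub_norm_le (t • a) (-(x 0 i))
  rwa [norm_neg, sub_neg_eq_add, add_comm (t • a), norm_smul, Real.norm_of_nonneg ht] at h2

end Motion

/-! ### Existence and classification of equilibrium solutions -/

section Equilibrium

variable {n m : ℕ} {G : SimpleGraph (Fin n)} {o : OrientedLabelling G m} {d : Fin m → ℝ}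
  {T : Finset (Fin m)} {y : Config n} {A : Set (Config n)}

theorem IsEquilibriumSolution.redErr_eq {μ : Fin m → ℝ} {ε : {k // k ∈ T} → ℝ}
    {x : ℝ → Config n} (hx : IsEquilibriumSolution o d A μ (eqOutput o d T A ε) x) {t : ℝ}
    (ht : 0 ≤ t) : redErr o d T (x t) = ε := by
  funext k
  rw [redErr, hx.err_eq t ht, eqOutput, dif_pos k.2]

/-- Every equilibrium solution is a rigid motion whose initial velocities are those prescribed by
the overall system. -/
theorem IsEquilibriumSolution.exists_rigidMotion (hn : 3 ≤ n) (hA : IsAmbientSpace o d T y A)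
    {μ : Fin m → ℝ} {ε : {k // k ∈ T} → ℝ} (hε : errorField o d T A ε μ = 0) {x : ℝ → Config n}
    (hx : IsEquilibriumSolution o d A μ (eqOutput o d T A ε) x) :
    ∃ (a : Plane) (w : ℝ),
      (∀ i, forceField o (eqOutput o d T A ε) μ (x 0) i = a + w • quarterTurn (x 0 i)) ∧
      ∀ t, 0 ≤ t → ∀ i, x t i = rigidMotion a w t (x 0 i) := by
  obtain ⟨a, w, h⟩ := hA.exists_forceField_eq hn (μ := μ) (hx.mem 0 le_rfl)
    (by rwa [hx.redErr_eq le_rfl])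
  rw [hx.err_eq 0 le_rfl] at h
  exact ⟨a, w, h, fun t ht => hx.eq_rigidMotion h ht⟩

theorem exists_isEquilibriumSolution (hn : 3 ≤ n) (hA : IsAmbientSpace o d T y A)
    {μ : Fin m → ℝ} {ε : {k // k ∈ T} → ℝ} (hmem : ε ∈ redErr o d T '' A)
    (hε : errorField o d T A ε μ = 0) :
    ∃ x, IsEquilibriumSolution o d A μ (eqOutput o d T A ε) x := by
  obtain ⟨x₀, hx₀, rfl⟩ := hmem
  obtain ⟨a, w, h⟩ := hA.exists_forceField_eq hn hx₀ hε
  rw [hA.eqOutput_redErr hx₀]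
  exact ⟨_, hA.isEquilibriumSolution_rigidMotion hx₀ h⟩

/-- The squared speed of an agent is a combination of inner products of relative positions, so it is
the same at the start of all equilibrium solutions for a given `ε` and `μ`. -/
theorem stationary_or_drifts (hn : 3 ≤ n) (hA : IsAmbientSpace o d T y A)
    {μ : Fin m → ℝ} {ε : {k // k ∈ T} → ℝ} (hmem : ε ∈ redErr o d T '' A)
    (hε : errorField o d T A ε μ = 0) :
    (∀ x, IsEquilibriumSolution o d A μ (eqOutput o d T A ε) x → RelPosConst o x →
      Stationary x) ∨
    (∀ x, IsEquilibriumSolution o d A μ (eqOutput o d T A ε) x → RelPosConst o x →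
      Drifts x) := by
  have key : ∀ x, IsEquilibriumSolution o d A μ (eqOutput o d T A ε) x → RelPosConst o x →
      ∃ a : Plane, (∀ i, forceField o (eqOutput o d T A ε) μ (x 0) i = a) ∧
        ∀ t, 0 ≤ t → ∀ i, x t i = rigidMotion a 0 t (x 0 i) := by
    intro x hx hc
    obtain ⟨a, w, h, hm⟩ := hx.exists_rigidMotion hn hA hε
    obtain ⟨k, -, hk⟩ := (hA.minInfRigid _ (hx.mem 0 le_rfl)).1.exists_relPos_ne_zero hn
    have hw : w = 0 := by
      by_contra hw
      exact not_relPosConst_of_rigidMotion hw hk hm hc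
    subst hw
    exact ⟨a, fun i => by rw [h i, zero_smul, add_zero], hm⟩
  obtain ⟨x₀, hx₀, rfl⟩ := hmem
  -- Any agent serves: when `w = 0` all velocities coincide.
  let i : Fin n := ⟨0, by omega⟩
  have hnorm : ∀ x, IsEquilibriumSolution o d A μ (eqOutput o d T A (redErr o d T x₀)) x →
      inner ℝ (forceField o (eqOutput o d T A (redErr o d T x₀)) μ (x 0) i)
        (forceField o (eqOutput o d T A (redErr o d T x₀)) μ (x 0) i)
      = inner ℝ (forceField o (eqOutput o d T A (redErr o d T x₀)) μ x₀ i)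
        (forceField o (eqOutput o d T A (redErr o d T x₀)) μ x₀ i) := by
    intro x hx
    simp only [inner_forceField]
    refine Finset.sum_congr rfl fun k _ => ?_
    rw [real_inner_comm, real_inner_comm _ (relPos o x₀ k)]
    simp only [inner_forceField, relPos,
      hA.inner_congr (hx.mem 0 le_rfl) hx₀ (hx.redErr_eq le_rfl)]
  by_cases h0 : forceField o (eqOutput o d T A (redErr o d T x₀)) μ x₀ i = 0
  · left
    intro x hx hc
    obtain ⟨a, h, hm⟩ := key x hx hc
    have := hnorm x hx
    rw [h i, h0, inner_zero_left, inner_self_eq_zero] at this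
    subst this
    exact stationary_of_rigidMotion hm
  · right
    intro x hx hc
    obtain ⟨a, h, hm⟩ := key x hx hc
    refine drifts_of_rigidMotion (fun ha => h0 ?_) hm
    have := hnorm x hx
    rwa [h i, ha, inner_zero_left, eq_comm, inner_self_eq_zero] at this

end Equilibrium

end Formation

/-! ### Zero sets of noncritical functions -/

namespace Formation

open scoped ContDiff Topology Matrix

open MeasureTheory in
/-- A level set consisting of regular points is a null set. -/
theorem measure_zeroSet_eq_zero {E : Type*} [NormedAddCommGroup E] [NormedSpace ℝ E]
    [FiniteDimensional ℝ E] [MeasurableSpace E] [BorelSpace E] (ν : Measure E)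
    [ν.IsAddHaarMeasure] {f : E → ℝ} {s : Set E} (hs : MeasurableSet s)
    (hf : ∀ x ∈ s, DifferentiableAt ℝ f x) (h0 : ∀ x ∈ s, f x = 0)
    (hf' : ∀ x ∈ s, fderiv ℝ f x ≠ 0) : ν s = 0 := by
  rcases s.eq_empty_or_nonempty with rfl | ⟨x₀, hx₀⟩
  · exact measure_empty
  obtain ⟨v, hv⟩ : ∃ v, fderiv ℝ f x₀ v ≠ 0 := by
    by_contra! hc
    exact hf' x₀ hx₀ (ContinuousLinearMap.ext hc)
  have hv0 : v ≠ 0 := by rintro rfl; exact hv (map_zero _)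
  -- As `f` vanishes on `s`, the map `f • v` is approximated there by `0` with constant `0`, so its
  -- derivative is zero almost everywhere on `s`. Since it never is zero, `s` is null. The vector
  -- `v` only serves to obtain a map from `E` to itself.
  have happ : ApproximatesLinearOn (fun x => f x • v) (0 : E →L[ℝ] E) s 0 := by
    intro x hx x' hx'
    simp [h0 x hx, h0 x' hx']
  have hae := happ.norm_fderiv_sub_le ν hs (fun x => (fderiv ℝ f x).smulRight v) fun x hx =>
    ((hf x hx).hasFDerivAt.smul_const v).hasFDerivWithinAt
  have hfalse : ∀ᵐ x ∂ν.restrict s, False := by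
    filter_upwards [hae, ae_restrict_mem hs] with x hx hxs
    rw [sub_zero, nonpos_iff_eq_zero, nnnorm_eq_zero] at hx
    refine hf' x hxs (ContinuousLinearMap.ext fun u => ?_)
    have := congrArg (fun L : E →L[ℝ] E => L u) hx
    simpa [hv0] using this
  simpa [ae_iff] using hfalse

open MeasureTheory in
/-- Near a point at which none of finitely many smooth functions is critical, these functions are
all nonzero on an open dense set with a null complement. -/
theorem exists_open_dense_ne_zero {E ι : Type*} [Finite ι] [NormedAddCommGroup E]
    [NormedSpace ℝ E] [FiniteDimensional ℝ E] [MeasurableSpace E] [BorelSpace E] (ν : Measure E)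
    [ν.IsAddHaarMeasure] {M : Set E} (hM : IsOpen M) {a : E} (ha : a ∈ M) {f : ι → E → ℝ}
    (hf : ∀ i, ContDiffOn ℝ ∞ (f i) M) (hf' : ∀ i, fderiv ℝ (f i) a ≠ 0) :
    ∃ M₀ U : Set E, IsOpen M₀ ∧ a ∈ M₀ ∧ M₀ ⊆ M ∧ IsOpen U ∧ U ⊆ M₀ ∧ M₀ ⊆ closure U ∧
      ν (M₀ \ U) = 0 ∧ ∀ x ∈ U, ∀ i, f i x ≠ 0 := by
  let M₀ : Set E := M ∩ ⋂ i, M ∩ fderiv ℝ (f i) ⁻¹' {0}ᶜ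
  let U : Set E := M₀ ∩ ⋂ i, M ∩ f i ⁻¹' {0}ᶜ
  have hV : ∀ i, IsOpen (M ∩ f i ⁻¹' {0}ᶜ) := fun i =>
    (hf i).continuousOn.isOpen_inter_preimage hM isOpen_compl_singleton
  have hM₀ : IsOpen M₀ := hM.inter <| isOpen_iInter_of_finite fun i =>
    ((hf i).continuousOn_fderiv_of_isOpen hM (by simp)).isOpen_inter_preimage hM
      isOpen_compl_singleton
  have hnull : ν (M₀ \ U) = 0 := by
    have hsub : M₀ \ U ⊆ ⋃ i, M₀ \ (M ∩ f i ⁻¹' {0}ᶜ) := by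
      rintro x ⟨hx, hxU⟩
      have : x ∉ ⋂ i, M ∩ f i ⁻¹' {0}ᶜ := fun h => hxU ⟨hx, h⟩
      rw [Set.mem_iInter, not_forall] at this
      obtain ⟨i, hi⟩ := this
      exact Set.mem_iUnion.2 ⟨i, hx, hi⟩
    refine measure_mono_null hsub (measure_iUnion_null fun i => ?_)
    refine measure_zeroSet_eq_zero ν (f := f i) (hM₀.measurableSet.diff (hV i).measurableSet)
      (fun x hx => ?_) (fun x hx => ?_) (fun x hx => ?_)
    · exact ((hf i).contDiffAt (hM.mem_nhds hx.1.1)).differentiableAt (by simp)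
    · by_contra h
      exact hx.2 ⟨hx.1.1, h⟩
    · exact (Set.mem_iInter.1 hx.1.2 i).2
  refine ⟨M₀, U, hM₀, ⟨ha, Set.mem_iInter.2 fun i => ⟨ha, hf' i⟩⟩, Set.inter_subset_left,
    hM₀.inter (isOpen_iInter_of_finite hV), Set.inter_subset_left, fun x hx => ?_, hnull,
    fun x hx i => (Set.mem_iInter.1 hx.2 i).2⟩
  rw [mem_closure_iff]
  intro V hVo hxV
  by_contra hc
  have hsub : V ∩ M₀ ⊆ M₀ \ U := fun z hz => ⟨hz.2, fun hzU => hc ⟨z, hz.1, hzU⟩⟩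
  have hz : ν (V ∩ M₀) = 0 := measure_mono_null hsub hnull
  have hmem : x ∈ V ∩ M₀ := ⟨hxV, hx⟩
  rw [(hVo.inter hM₀).eq_empty_of_measure_zero hz] at hmem
  exact hmem

/-! ### First-order velocities of a rigid formation -/

section Rigid

variable {n m : ℕ} {G : SimpleGraph (Fin n)} {o : OrientedLabelling G m} {T : Finset (Fin m)}
  {y : Config n}

theorem exists_third (hn : 3 ≤ n) (p q : Fin n) : ∃ r, r ≠ p ∧ r ≠ q := by
  obtain ⟨r, hr⟩ := Finset.exists_mem_notMem_of_card_lt_card (s := {p, q}) (t := Finset.univ)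
    (lt_of_le_of_lt Finset.card_le_two (by simp; omega))
  refine ⟨r, ?_⟩
  simpa using hr

/-- No single agent of a rigid formation can move infinitesimally. -/
theorem SubInfRigid.eq_zero_of_single (hn : 3 ≤ n) (h : SubInfRigid o T y) {p q r : Fin n}
    (hp : p ≠ r) (hq : q ≠ r) (hpq : y p ≠ y q) {u : Config n}
    (hu : ∀ k ∈ T, rigMap o y u k = 0) (hu0 : ∀ i, i ≠ r → u i = 0) : u r = 0 := by
  obtain ⟨a, w, hw⟩ := h.exists_trivial hn hu
  -- The two agents at rest form a multi-point of their own, on which the trivial motion vanishes;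
  -- it is therefore zero.
  have h1 : trivialMotion (fun i : Fin 2 => if i = 0 then y p else y q) (a, w) = 0 := by
    funext i
    fin_cases i
    · exact (hw p).symm.trans (hu0 p hp)
    · exact (hw q).symm.trans (hu0 q hq)
  have h2 := (injective_iff_map_eq_zero _).1
    (trivialMotion_injective (x := fun i : Fin 2 => if i = 0 then y p else y q)
      (i := 0) (j := 1) (by simpa using hpq)) _ h1
  obtain ⟨rfl, rfl⟩ := Prod.mk_eq_zero.1 h2
  rw [hw r]; simp

/-- The edges of a rigid formation are not all parallel. -/
theorem SubInfRigid.eq_zero_of_inner_eq_zero (hn : 3 ≤ n) (h : SubInfRigid o T y) {b : Plane}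
    (hb : ∀ k ∈ T, inner ℝ (relPos o y k) b = 0) : b = 0 := by
  obtain ⟨p, q, hpq⟩ := h.exists_ne hn
  obtain ⟨r, hp, hq⟩ := exists_third hn p q
  have := h.eq_zero_of_single hn hp.symm hq.symm hpq
    (u := fun i => (if i = r then (1 : ℝ) else 0) • b)
    (fun k hk => by rw [rigMap_apply, ← sub_smul, inner_smul_right, hb k hk, mul_zero])
    (fun i hi => by simp [hi])
  simpa using this

/-- The lines through the edges of a rigid formation do not all pass through the centroid. -/
theorem SubInfRigid.exists_inner_quarterTurn_ne_zero (hn : 3 ≤ n) (h : SubInfRigid o T y)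
    {c : Plane} (hc : ∑ i, (y i - c) = 0) :
    ∃ k ∈ T, inner ℝ (relPos o y k) (quarterTurn (y (o.tail k) - c)) ≠ 0 := by
  by_contra! hk
  have hk' : ∀ k ∈ T, inner ℝ (relPos o y k) (quarterTurn (y (o.head k) - c)) = 0 := by
    intro k hkT
    have hsub : y (o.head k) - c = relPos o y k + (y (o.tail k) - c) := by
      simp [relPos]
    rw [hsub, map_add, inner_add_right, hk k hkT, add_zero, real_inner_comm,
      inner_quarterTurn_self]
  -- If every edge line passes through `c`, moving agent `r` alone in the direction `J(y r - c)`
  -- preserves all edge lengths to first order, so that direction must be zero.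
  have key : ∀ p q r, p ≠ r → q ≠ r → y p ≠ y q → y r = c := by
    intro p q r hp hq hpq
    have := h.eq_zero_of_single hn hp hq hpq
      (u := fun i => (if i = r then (1 : ℝ) else 0) • quarterTurn (y i - c))
      (fun k hkT => by
        rw [rigMap_apply, inner_sub_right, inner_smul_right, inner_smul_right, hk k hkT,
          hk' k hkT]
        ring)
      (fun i hi => by simp [hi])
    simp only [if_true, one_smul] at this
    exact sub_eq_zero.1 (quarterTurn_eq_zero.1 this)
  -- With `p` away from `c` and `r` at `c`, `key` puts every agent except `p` at `c`; the centroid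
  -- condition then puts `p` there as well.
  have key' : ∀ p r, r ≠ p → y r = c → y p = c := by
    intro p r hrp hr
    by_contra hp
    refine hp (sub_eq_zero.1 ?_)
    rw [← hc, Finset.sum_eq_single p (fun s _ hs => ?_) (by simp)]
    by_cases hsr : s = r
    · rw [hsr, hr, sub_self]
    · exact sub_eq_zero.2 (key p r s (Ne.symm hs) (Ne.symm hsr) (hr ▸ hp))
  obtain ⟨p, q, hpq⟩ := h.exists_ne hn
  obtain ⟨r, hp, hq⟩ := exists_third hn p q
  have hr := key p q r hp.symm hq.symm hpq
  exact hpq ((key' p r hp hr).trans (key' q r hq hr).symm)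

theorem exists_ne_zero_inner_eq_zero (s : Plane) :
    ∃ b : Plane, b ≠ 0 ∧ inner ℝ (quarterTurn s) b = 0 := by
  by_cases hs : s = 0
  · refine ⟨!₂[1, 0], fun h => ?_, by simp [hs]⟩
    have := congrArg (fun p : Plane => p 0) h
    simp at this
  · exact ⟨s, hs, inner_quarterTurn_self s⟩

/-- Whatever the errors `E δ` are, some mismatch `δ` gives the agents of a rigid formation different
velocities. -/
theorem SubInfRigid.exists_forceField_ne (hn : 3 ≤ n) (h : SubInfRigid o T y)
    (E : (Fin m → ℝ) → Fin m → ℝ) :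
    ∃ δ i j, forceField o (E δ) δ y i ≠ forceField o (E δ) δ y j := by
  by_contra! hc
  let i₀ : Fin n := ⟨0, by omega⟩
  have hn0 : (n : ℝ) ≠ 0 := by positivity
  let c : Plane := (n : ℝ)⁻¹ • ∑ i, y i
  have hsum : ∑ i, (y i - c) = 0 := by
    rw [Finset.sum_sub_distrib, Finset.sum_const, Finset.card_univ, Fintype.card_fin,
      ← Nat.cast_smul_eq_nsmul ℝ, smul_smul, mul_inv_cancel₀ hn0, one_smul, sub_self]
  obtain ⟨k, -, hk⟩ := h.exists_inner_quarterTurn_ne_zero hn hsum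
  have htriv : (fun i => quarterTurn (y i - c)) = trivialMotion y (-quarterTurn c, 1) := by
    funext i; simp [trivialMotion]; abel
  -- Virtual work against the rotation about the centroid: the error term vanishes because the
  -- rotation is trivial, and a common velocity does no work because the offsets from `c` sum to
  -- zero. Only the term of edge `k` remains.
  have hw := sum_inner_forceField o (E (Pi.single k 1)) (Pi.single k 1) y
    fun i => quarterTurn (y i - c)
  rw [htriv, rigMap_trivialMotion] at hw
  simp only [hc (Pi.single k 1) _ i₀, ← inner_sum, ← map_sum, hsum, map_zero, inner_zero_right,
    Pi.zero_apply, mul_zero, Finset.sum_const_zero, neg_zero, zero_add] at hw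
  rw [Finset.sum_eq_single k (fun l _ hl => by simp [hl]) (by simp)] at hw
  simp only [Pi.single_eq_same, one_mul] at hw
  exact hk hw.symm

/-- If the velocities always are those of an infinitesimal rigid motion, then every agent moves
for some mismatch `δ`. -/
theorem SubInfRigid.exists_forceField_ne_zero (hn : 3 ≤ n) (h : SubInfRigid o T y)
    (E : (Fin m → ℝ) → Fin m → ℝ)
    (hE : ∀ δ, ∀ k ∈ T, rigMap o y (forceField o (E δ) δ y) k = 0) (i : Fin n) :
    ∃ δ, forceField o (E δ) δ y i ≠ 0 := by
  by_contra! hc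
  -- If agent `i` rests, the velocities are `w J(y l - y i)` and their sum is a multiple of `J ∑ (y
  -- l - y i)`. With `b` orthogonal to it, the translation by `b` yields no work, and each edge `k`
  -- would be orthogonal to `b`.
  obtain ⟨b, hb, hbs⟩ := exists_ne_zero_inner_eq_zero (∑ l, (y l - y i))
  refine hb (h.eq_zero_of_inner_eq_zero hn fun k _ => ?_)
  obtain ⟨a, w, hV⟩ := h.exists_trivial hn (hE (Pi.single k 1))
  have hV' : ∀ l, forceField o (E (Pi.single k 1)) (Pi.single k 1) y l
      = w • quarterTurn (y l - y i) := by
    intro l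
    have h1 := hc (Pi.single k 1)
    rw [hV i] at h1
    rw [hV l, eq_neg_of_add_eq_zero_left h1, map_sub, smul_sub]
    abel
  have hw := sum_inner_forceField o (E (Pi.single k 1)) (Pi.single k 1) y fun _ => b
  rw [← sum_inner, Finset.sum_congr rfl fun l _ => hV' l, ← Finset.smul_sum, ← map_sum,
    inner_smul_left, hbs, mul_zero] at hw
  simp only [rigMap_apply, sub_self, inner_zero_right, mul_zero, Finset.sum_const_zero, neg_zero,
    zero_add] at hw
  rw [Finset.sum_eq_single k (fun l _ hl => by simp [hl]) (by simp)] at hw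
  simpa using hw.symm

theorem SubInfRigid.exists_inner_sub_ne_zero (hn : 3 ≤ n) (h : SubInfRigid o T y) {b : Plane}
    (hb : b ≠ 0) : ∃ p q, inner ℝ b (y p - y q) ≠ 0 := by
  by_contra! hc
  exact hb (h.eq_zero_of_inner_eq_zero hn fun k _ => by rw [real_inner_comm]; exact hc _ _)

end Rigid

/-! ### Rotation for almost all mismatches -/

section Generic

variable {n m : ℕ} {G : SimpleGraph (Fin n)} {o : OrientedLabelling G m} {d : Fin m → ℝ}
  {T : Finset (Fin m)} {y : Config n} {A : Set (Config n)}

variable (o d T A) in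
/-- The inner product of the velocity of agent `i` with the position of `p` relative to `q`, when
the reduced error is `ε`. -/
noncomputable def velInner (i p q : Fin n) (ε : {k // k ∈ T} → ℝ) (μ : Fin m → ℝ) : ℝ :=
  ∑ k, forceCoeff o (eqOutput o d T A ε) μ i k *
    inner ℝ (pointOf o d T A ε (o.head k) - pointOf o d T A ε (o.tail k))
      (pointOf o d T A ε p - pointOf o d T A ε q)

theorem IsAmbientSpace.velInner_redErr (hA : IsAmbientSpace o d T y A) {x₀ : Config n}
    (hx : x₀ ∈ A) (i p q : Fin n) (μ : Fin m → ℝ) :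
    velInner o d T A i p q (redErr o d T x₀) μ
      = inner ℝ (forceField o (eqOutput o d T A (redErr o d T x₀)) μ x₀ i) (x₀ p - x₀ q) := by
  have hε : redErr o d T x₀ ∈ redErr o d T '' A := ⟨x₀, hx, rfl⟩
  simp only [velInner, inner_forceField, relPos,
    hA.inner_congr (pointOf_mem hε) hx (redErr_pointOf hε)]

variable {M : Set (Fin m → ℝ)} {ε : (Fin m → ℝ) → ({k // k ∈ T} → ℝ)}

theorem IsEquilibriumBranch.contDiffOn_eqOutput (hA : IsAmbientSpace o d T y A)
    (hb : IsEquilibriumBranch o d T A M ε) :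
    ContDiffOn ℝ ∞ (fun μ => eqOutput o d T A (ε μ)) M :=
  hA.contDiffOn_eqOutput.comp hb.smooth hb.mem_domain

theorem IsEquilibriumBranch.contDiffOn_inner (hA : IsAmbientSpace o d T y A)
    (hb : IsEquilibriumBranch o d T A M ε) (i j k l : Fin n) :
    ContDiffOn ℝ ∞ (fun μ => inner ℝ (pointOf o d T A (ε μ) i - pointOf o d T A (ε μ) j)
      (pointOf o d T A (ε μ) k - pointOf o d T A (ε μ) l)) M :=
  (hA.contDiffOn_inner_pointOf i j k l).comp hb.smooth hb.mem_domain

theorem IsEquilibriumBranch.contDiffOn_velInner (hA : IsAmbientSpace o d T y A)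
    (hb : IsEquilibriumBranch o d T A M ε) (i p q : Fin n) :
    ContDiffOn ℝ ∞ (fun μ => velInner o d T A i p q (ε μ) μ) M := by
  unfold velInner
  refine ContDiffOn.sum fun k _ => ContDiffOn.mul ?_ (hb.contDiffOn_inner hA _ _ _ _)
  have hE := contDiffOn_pi.1 (hb.contDiffOn_eqOutput hA) k
  have hk : ContDiff ℝ ∞ fun μ : Fin m → ℝ => μ k := by fun_prop
  unfold forceCoeff
  refine ContDiffOn.sub ?_ ?_
  · split_ifs
    · exact hE.add hk.contDiffOn
    · exact contDiffOn_const
  · split_ifs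
    · exact hE
    · exact contDiffOn_const

/-- At `μ = 0` the force coefficients vanish, so only their derivative contributes, while the inner
products are evaluated at the target formation. -/
theorem IsEquilibriumBranch.fderiv_velInner (hA : IsAmbientSpace o d T y A)
    (hy : IsTargetFormation o d y) (hb : IsEquilibriumBranch o d T A M ε) (i p q : Fin n)
    (δ : Fin m → ℝ) :
    fderiv ℝ (fun μ => velInner o d T A i p q (ε μ) μ) 0 δ
      = inner ℝ (forceField o (fderiv ℝ (fun μ => eqOutput o d T A (ε μ)) 0 δ) δ y i)
          (y p - y q) := by
  have hnhds := hb.isOpen.mem_nhds hb.zero_mem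
  have hdiff : ∀ {F : Type} [NormedAddCommGroup F] [NormedSpace ℝ F] {f : (Fin m → ℝ) → F},
      ContDiffOn ℝ ∞ f M → DifferentiableAt ℝ f 0 := fun hf =>
    (hf.contDiffAt hnhds).differentiableAt (by simp)
  refine (hasDerivAt_comp_smul (hdiff (hb.contDiffOn_velInner hA i p q)) δ).unique ?_
  have h0 := hA.zero_mem hy
  simp only [velInner, inner_forceField, relPos]
  refine HasDerivAt.fun_sum fun k _ => ?_
  have h1 := (hasDerivAt_comp_smul (hdiff (hb.contDiffOn_inner hA (o.head k) (o.tail k) p q))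
    δ).differentiableAt
  have hE := hasDerivAt_pi.1 (hasDerivAt_comp_smul (hdiff (hb.contDiffOn_eqOutput hA)) δ) k
  have hk : HasDerivAt (fun t : ℝ => (t • δ) k) (δ k) 0 := by
    simpa using (hasDerivAt_id (0 : ℝ)).mul_const (δ k)
  have h2 : HasDerivAt (fun t : ℝ => forceCoeff o (eqOutput o d T A (ε (t • δ))) (t • δ) i k)
      (forceCoeff o (fderiv ℝ (fun μ => eqOutput o d T A (ε μ)) 0 δ) δ i k) 0 := by
    unfold forceCoeff
    refine HasDerivAt.sub ?_ ?_
    · split_ifs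
      · exact hE.add hk
      · exact hasDerivAt_const _ _
    · split_ifs
      · exact hE
      · exact hasDerivAt_const _ _
  have h3 := hasDerivAt_mul_of_right_eq_zero h1 h2 (by
    simp [hb.map_zero, hA.eqOutput_zero hy, forceCoeff])
  simp only [zero_smul, hb.map_zero] at h3
  rw [hA.inner_congr (pointOf_mem h0) hA.mem ((redErr_pointOf h0).trans (redErr_target hy).symm)]
    at h3
  simpa only [mul_comm] using h3

/-- For every `μ` in `M` the velocities are those of a rigid motion, so head and tail of an edge
have equal velocity components along it. This is the derivative of that identity at `0`. -/
theorem IsEquilibriumBranch.rigMap_fderiv (hn : 3 ≤ n) (hA : IsAmbientSpace o d T y A)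
    (hy : IsTargetFormation o d y) (hb : IsEquilibriumBranch o d T A M ε) (δ : Fin m → ℝ)
    (k : Fin m) :
    rigMap o y (forceField o (fderiv ℝ (fun μ => eqOutput o d T A (ε μ)) 0 δ) δ y) k = 0 := by
  have hnhds := hb.isOpen.mem_nhds hb.zero_mem
  have heq : (fun μ => velInner o d T A (o.head k) (o.head k) (o.tail k) (ε μ) μ) =ᶠ[𝓝 0]
      fun μ => velInner o d T A (o.tail k) (o.head k) (o.tail k) (ε μ) μ := by
    filter_upwards [hnhds] with μ hμ
    obtain ⟨x₀, hx₀, hε⟩ := hb.mem_domain μ hμ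
    obtain ⟨a, w, h⟩ := hA.exists_forceField_eq hn hx₀ (by rw [hε]; exact hb.equilibrium μ hμ)
    rw [← hε, hA.velInner_redErr hx₀, hA.velInner_redErr hx₀, hA.eqOutput_redErr hx₀, h, h,
      ← sub_eq_zero, ← inner_sub_left, add_sub_add_left_eq_sub, ← smul_sub, ← map_sub,
      inner_smul_left, inner_quarterTurn_self, mul_zero]
  have := congrArg (fun L : (Fin m → ℝ) →L[ℝ] ℝ => L δ) heq.fderiv_eq
  simp only [hb.fderiv_velInner hA hy] at this
  rw [rigMap_apply, real_inner_comm, inner_sub_left]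
  exact sub_eq_zero.2 this

/-- For almost all small mismatches the formation rotates about a point at which no agent is. -/
theorem IsEquilibriumBranch.exists_generic_rotation (hn : 3 ≤ n) (hA : IsAmbientSpace o d T y A)
    (hy : IsTargetFormation o d y) (hb : IsEquilibriumBranch o d T A M ε) :
    ∃ M₀ U : Set (Fin m → ℝ), IsOpen M₀ ∧ 0 ∈ M₀ ∧ M₀ ⊆ M ∧
      IsOpen U ∧ U ⊆ M₀ ∧ M₀ ⊆ closure U ∧ MeasureTheory.volume (M₀ \ U) = 0 ∧
      ∀ μ ∈ U, ∀ x, IsEquilibriumSolution o d A μ (eqOutput o d T A (ε μ)) x →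
        ¬ RelPosConst o x ∧ ∃ w σ q, RotatesAbout x w σ q ∧ ∀ i, x 0 i ≠ q := by
  have hT := (hA.minInfRigid y hA.mem).1
  obtain ⟨δ₀, i₀, j₀, h₀⟩ := hT.exists_forceField_ne hn
    fun δ => fderiv ℝ (fun μ => eqOutput o d T A (ε μ)) 0 δ
  obtain ⟨p₀, q₀, hpq₀⟩ := hT.exists_inner_sub_ne_zero hn (sub_ne_zero.2 h₀)
  choose δ hδ using hT.exists_forceField_ne_zero hn
    (fun δ => fderiv ℝ (fun μ => eqOutput o d T A (ε μ)) 0 δ)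
    (fun δ k _ => hb.rigMap_fderiv hn hA hy δ k)
  choose p q hpq using fun i => hT.exists_inner_sub_ne_zero hn (hδ i)
  -- The function at `none` vanishes if all velocities agree, that is, if `w = 0`; the one at `some
  -- i` vanishes if agent `i` is at the centre of rotation.
  let f : Option (Fin n) → (Fin m → ℝ) → ℝ := fun s => s.elim
    (fun μ => velInner o d T A i₀ p₀ q₀ (ε μ) μ - velInner o d T A j₀ p₀ q₀ (ε μ) μ)
    (fun i μ => velInner o d T A i (p i) (q i) (ε μ) μ)
  have hsm := hb.contDiffOn_velInner hA
  have hd : ∀ i p q, DifferentiableAt ℝ (fun μ => velInner o d T A i p q (ε μ) μ) 0 :=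
    fun i p q => ((hsm i p q).contDiffAt (hb.isOpen.mem_nhds hb.zero_mem)).differentiableAt
      (by simp)
  obtain ⟨M₀, U, h1, h2, h3, h4, h5, h6, h7, hU⟩ :=
    exists_open_dense_ne_zero MeasureTheory.volume hb.isOpen hb.zero_mem (f := f)
    (by
      rintro (_ | i)
      · exact (hsm i₀ p₀ q₀).sub (hsm j₀ p₀ q₀)
      · exact hsm i (p i) (q i))
    (by
      rintro (_ | i) h
      · have h' := congrArg (fun L : (Fin m → ℝ) →L[ℝ] ℝ => L δ₀) h
        change fderiv ℝ (fun μ => velInner o d T A i₀ p₀ q₀ (ε μ) μ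
          - velInner o d T A j₀ p₀ q₀ (ε μ) μ) 0 δ₀ = 0 at h'
        rw [fderiv_fun_sub (hd _ _ _) (hd _ _ _), _root_.sub_apply,
          hb.fderiv_velInner hA hy, hb.fderiv_velInner hA hy, ← inner_sub_left] at h'
        exact hpq₀ h'
      · have h' := congrArg (fun L : (Fin m → ℝ) →L[ℝ] ℝ => L (δ i)) h
        change fderiv ℝ (fun μ => velInner o d T A i (p i) (q i) (ε μ) μ) 0 (δ i) = 0 at h'
        rw [hb.fderiv_velInner hA hy] at h'
        exact hpq i h')
  refine ⟨M₀, U, h1, h2, h3, h4, h5, h6, h7, fun μ hμ x hx => ?_⟩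
  have hμM : μ ∈ M := h3 (h5 hμ)
  obtain ⟨a, w, hV, hm⟩ := hx.exists_rigidMotion hn hA (hb.equilibrium μ hμM)
  have hx0 := hx.mem 0 le_rfl
  have hvel : ∀ i p q, velInner o d T A i p q (ε μ) μ
      = inner ℝ (a + w • quarterTurn (x 0 i)) (x 0 p - x 0 q) := by
    intro i p q
    rw [← hV i, ← hx.redErr_eq (le_refl 0)]
    exact hA.velInner_redErr hx0 i p q μ
  have hw : w ≠ 0 := by
    rintro rfl
    refine hU μ hμ none ?_
    change velInner o d T A i₀ p₀ q₀ (ε μ) μ - velInner o d T A j₀ p₀ q₀ (ε μ) μ = 0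
    rw [hvel, hvel, zero_smul, zero_smul, sub_self]
  obtain ⟨k, -, hk⟩ := (hA.minInfRigid _ hx0).1.exists_relPos_ne_zero hn
  refine ⟨not_relPosConst_of_rigidMotion hw hk hm, _, _, _, rotatesAbout_of_rigidMotion hw hm,
    fun i hi => hU μ hμ (some i) ?_⟩
  change velInner o d T A i (p i) (q i) (ε μ) μ = 0
  rw [hvel, hi, map_smul, quarterTurn_quarterTurn, smul_smul, mul_inv_cancel₀ hw, one_smul,
    add_neg_cancel, inner_zero_left]

end Generic

end Formation

theorem theorem3 {n m : ℕ} (hn : 3 ≤ n) (G : SimpleGraph (Fin n)) (o : OrientedLabelling G m)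
    (d : Fin m → ℝ) (y : Config n) (hy : IsTargetFormation o d y)
    (T : Finset (Fin m)) (hT : SubMinInfRigid o T y) :
    (∃ A : Set (Config n), IsAmbientSpace o d T y A) ∧
    ∀ A : Set (Config n), IsAmbientSpace o d T y A →
      (∃ (M : Set (Fin m → ℝ)) (ε : (Fin m → ℝ) → ({k // k ∈ T} → ℝ)),
        IsEquilibriumBranch o d T A M ε) ∧
      ∀ (M : Set (Fin m → ℝ)) (ε : (Fin m → ℝ) → ({k // k ∈ T} → ℝ)),
        IsEquilibriumBranch o d T A M ε →
        (∀ μ ∈ M,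
          (∃ x, IsEquilibriumSolution o d A μ (eqOutput o d T A (ε μ)) x) ∧
          (∀ x, IsEquilibriumSolution o d A μ (eqOutput o d T A (ε μ)) x →
            ∀ t, 0 ≤ t → InfRigid o (x t) ∧
              ∀ k, ‖x t (o.head k) - x t (o.tail k)‖
                = Real.sqrt (eqOutput o d T A (ε μ) k + d k ^ 2)) ∧
          ((∀ x, IsEquilibriumSolution o d A μ (eqOutput o d T A (ε μ)) x →
              RelPosConst o x → Stationary x) ∨
            (∀ x, IsEquilibriumSolution o d A μ (eqOutput o d T A (ε μ)) x →
              RelPosConst o x → Drifts x)) ∧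
          (∀ x, IsEquilibriumSolution o d A μ (eqOutput o d T A (ε μ)) x →
            ¬ RelPosConst o x → ∃ ω σ q, RotatesAbout x ω σ q)) ∧
        (Unaligned y →
          ∃ M₀ U : Set (Fin m → ℝ), IsOpen M₀ ∧ 0 ∈ M₀ ∧ M₀ ⊆ M ∧
            IsOpen U ∧ U ⊆ M₀ ∧ M₀ ⊆ closure U ∧ MeasureTheory.volume (M₀ \ U) = 0 ∧
            ∀ μ ∈ U, ∀ x, IsEquilibriumSolution o d A μ (eqOutput o d T A (ε μ)) x →
              ¬ RelPosConst o x ∧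
              ∃ ω σ q, RotatesAbout x ω σ q ∧ ∀ i, x 0 i ≠ q) := by
  refine ⟨exists_isAmbientSpace hn hT, fun A hA =>
    ⟨hA.exists_isEquilibriumBranch hn hy, fun M ε hb => ⟨fun μ hμ => ?_, fun _ =>
      hb.exists_generic_rotation hn hA hy⟩⟩⟩
  have hmem := hb.mem_domain μ hμ
  have hg := hb.equilibrium μ hμ
  refine ⟨exists_isEquilibriumSolution hn hA hmem hg, fun x hx t ht => ⟨?_, fun k => ?_⟩,
    stationary_or_drifts hn hA hmem hg, fun x hx hc => ?_⟩
  · exact (hA.minInfRigid _ (hx.mem t ht)).1.infRigid hn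
  · rw [← hx.err_eq t ht, err, sub_add_cancel, Real.sqrt_sq (norm_nonneg _)]
    rfl
  · obtain ⟨a, w, -, hm⟩ := hx.exists_rigidMotion hn hA hg
    have hw : w ≠ 0 := by
      rintro rfl
      refine hc fun t ht => funext fun k => ?_
      simp [relPos, hm t ht, rigidMotion]
    exact ⟨_, _, _, rotatesAbout_of_rigidMotion hw hm⟩
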